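/- Let $f=\frac1n\sum_{i=1}^n f_i$ with $n\ge 1$ differentiable functions $f_i:\mathbb{R}^d\to\mathbb{R}$, each $\mu$-strongly convex with $L$-Lipschitz gradient ($\mu,L>0$). Let $x^\star=\arg\min f$, $u_i^\star=\arg\min f_i$, $\zeta=\max_i\|x^\star-u_i^\star\|$. The algorithm AREA with $M\ge1$ local steps and step sizes $(\alpha_k)$ runs as follows. Initially the server has the model $x_{s,0}$ and the aggregator $u_{s,0}=0$, and each client $i$ has the memory $y_i=x_{s,0}$ and receives $(x_{s,0},\alpha_0)$. On receiving a pair $(x,\alpha)$, client $i$ sets $x_i^0=x$ and computes $x_i^m=x_i^{m-1}-\alpha\, g_i(x_i^{m-1})$ for $m=1,\dots,M$, where $g_i(\cdot)$ is a stochastic gradient of $f_i$. At each iteration $k\ge1$ exactly one event $J_k\in\{1,\dots,n,s\}$ occurs. If $J_k=i$, client $i$ delivers $m_i=x_i^M-y_i$ and sets $y_i\gets x_i^M$; the server sets $u_{s,k}=u_{s,k-1}+\frac1n m_i$, $x_{s,k}=x_{s,k-1}$ and sends $(x_{s,k-1},\alpha_k)$ to client $i$. If $J_k=s$, the server sets $x_{s,k}=x_{s,k-1}+u_{s,k-1}$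 and $u_{s,k}=0$. Assume that each $J_k$ is independent of all events and stochastic gradients that precede it, with $\Pr(J_k=i)=p_i>0$, $\Pr(J_k=s)=p_s>0$, $p_s+\sum_i p_i=1$ (so the events are IID), and that, conditionally on everything that precedes it, each stochastic gradient computed at a point $x$ satisfies $\mathbb{E}[g_i(x)-\nabla f_i(x)]=0$ and $\mathbb{E}\|g_i(x)-\nabla f_i(x)\|^2\le\sigma^2$, where $\sigma>0$. Put $p_{\min}=\min\{\min_ip_i,p_s\}$, $\gamma=\frac{2\mu L}{\mu+L}$ and $$\alpha_k=\frac{1}{\frac{p_{\min}M\gamma k}{48}+\frac1{\mathcal D}},\qquad \mathcal D=\min\left\{\tfrac{2}{M(\mu+L)},\ \tfrac{\gamma}{L^2(M-1)},\ \sqrt{\tfrac{M\gamma^2}{64L^4(M-1)^3}},\ \sqrt[3]{\tfrac{\gamma}{32L^4(M-1)^3}}\right\},$$ where for $M=1$ the last three members count as $+\infty$. Let $r_p=\frac{p_s}{p_{\min}}$, $\bar q=\frac1n\sum_i\frac1{p_i}$, $\kappa=\frac L\mu$, $\delta=1-\frac1M$ and $$\Phi(K)=\frac{r_p(1+\delta\kappa)\sigma^2}{p_{\min}MK}+\frac{r_p\bar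 q^{1/2}L(1+\delta\kappa)^{1/2}\sigma\zeta}{p_{\min}M^{1/2}K^{3/2}}+\frac{r_p\bar q^{1/2}L^{3/2}(\sigma\zeta^3)^{1/2}}{p_{\min}^{1/2}K^{3/2}}+\frac{r_p(\delta+p_{\min}^{1/2}\bar q)L^4\zeta^2}{p_{\min}^2K^2}.$$ Then $\mathbb{E}\|x_{s,K}-x^\star\|^2<\infty$ for all $K$, and $\mathbb{E}\|x_{s,K}-x^\star\|^2=\mathcal O(\Phi(K))$ as $K\to\infty$, in the following sense: there is an absolute constant $C>0$ such that $$\mathbb{E}\|x_{s,K}-x^\star\|^2\le C\,\max\{1,\mu^{-4}\}\,\Phi(K)\qquad\text{for all }K\ge K_0,$$ where $K_0$ depends only on $n,M,\mu,L$, the probabilities $p_1,\dots,p_n,p_s$, and an upper bound $\rho$ on $\|x_{s,0}-x^\star\|/\max\{\sigma,\zeta\}$ (in particular $K_0$ depends neither on $d$ nor, otherwise, on $\sigma$, $x_{s,0}$ or the functions). -/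

import Mathlib

open MeasureTheory ProbabilityTheory

namespace AREA

/-! ### The algorithm -/

/-- Local stochastic gradient steps `x^{m+1} = x^m - a • g m` from `x^0 = x`; here `g m` is the
value of the stochastic gradient that is computed at the current local iterate `x^m`. -/
def localSGD {d : ℕ} (a : ℝ) (x : EuclideanSpace ℝ (Fin d)) (g : ℕ → EuclideanSpace ℝ (Fin d)) :
    ℕ → EuclideanSpace ℝ (Fin d)
  | 0 => x
  | m + 1 => localSGD a x g m - a • g m

/-- Server model `xs`, aggregator `us`, client memories `y i`, and for each client the result
`loc i` of the `M` local steps on the model and step size that it received last. -/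
structure State (n d : ℕ) where
  xs : EuclideanSpace ℝ (Fin d)
  us : EuclideanSpace ℝ (Fin d)
  y : Fin n → EuclideanSpace ℝ (Fin d)
  loc : Fin n → EuclideanSpace ℝ (Fin d)

/-- One server iteration. The event `some i` is the arrival of the message `loc i - y i` of
client `i`, which then receives `xs` and the step size `a` and trains on them with the stochastic
gradients `g i`; the event `none` is an aggregation. -/
noncomputable def step {n d : ℕ} (M : ℕ) (a : ℝ) (g : Fin n → ℕ → EuclideanSpace ℝ (Fin d))
    (S : State n d) : Option (Fin n) → State n d
  | some i =>
      { xs := S.xs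
        us := S.us + (1 / (n : ℝ)) • (S.loc i - S.y i)
        y := Function.update S.y i (S.loc i)
        loc := Function.update S.loc i (localSGD a S.xs (g i) M) }
  | none =>
      { xs := S.xs + S.us
        us := 0
        y := S.y
        loc := S.loc }

/-- The state after `k` iterations. `j k` is the event of iteration `k` (`k ≥ 1`), and `g k i m` is
the stochastic gradient of client `i` at local step `m` of the local training started at
iteration `k` (for `k = 0`: on the initial broadcast of `x₀` and `α 0`). -/
noncomputable def iterate {n d : ℕ} (M : ℕ) (α : ℕ → ℝ) (x₀ : EuclideanSpace ℝ (Fin d))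
    (j : ℕ → Option (Fin n)) (g : ℕ → Fin n → ℕ → EuclideanSpace ℝ (Fin d)) : ℕ → State n d
  | 0 =>
      { xs := x₀
        us := 0
        y := fun _ => x₀
        loc := fun i => localSGD (α 0) x₀ (g 0 i) M }
  | k + 1 => step M (α (k + 1)) (g (k + 1)) (iterate M α x₀ j g k) (j (k + 1))

/-- The model that the server hands out at iteration `k`: the initial model for `k = 0`, and
`x_{s,k-1}` for `k ≥ 1`. -/
noncomputable def handedOut {n d : ℕ} (M : ℕ) (α : ℕ → ℝ) (x₀ : EuclideanSpace ℝ (Fin d))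
    (j : ℕ → Option (Fin n)) (g : ℕ → Fin n → ℕ → EuclideanSpace ℝ (Fin d)) :
    ℕ → EuclideanSpace ℝ (Fin d)
  | 0 => x₀
  | k + 1 => (iterate M α x₀ j g k).xs

/-- The point at which `g k i m` is computed: local iterate number `m` of client `i` in the local
training started at iteration `k`. -/
noncomputable def localPoint {n d : ℕ} (M : ℕ) (α : ℕ → ℝ) (x₀ : EuclideanSpace ℝ (Fin d))
    (j : ℕ → Option (Fin n)) (g : ℕ → Fin n → ℕ → EuclideanSpace ℝ (Fin d))
    (k : ℕ) (i : Fin n) (m : ℕ) : EuclideanSpace ℝ (Fin d) :=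
  localSGD (α k) (handedOut M α x₀ j g k) (g k i) m

/-! ### The probabilistic model -/

/-- The σ-algebra generated by the events `J 1, …, J k`. -/
abbrev eventHistory {Ω : Type*} {n : ℕ} (J : ℕ → Ω → Option (Fin n)) (k : ℕ) : MeasurableSpace Ω :=
  ⨆ l ∈ Finset.Icc 1 k, MeasurableSpace.comap (J l) ⊤

/-- The σ-algebra generated by all stochastic gradients of the local trainings started at the
iterations `0, …, k - 1`. -/
abbrev gradHistory {Ω : Type*} {n d : ℕ} (M : ℕ)
    (G : ℕ → Fin n → ℕ → Ω → EuclideanSpace ℝ (Fin d)) (k : ℕ) : MeasurableSpace Ω :=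
  ⨆ l ∈ Finset.range k, ⨆ i : Fin n, ⨆ m ∈ Finset.range M,
    MeasurableSpace.comap (G l i m) inferInstance

/-- Everything that has happened up to and including iteration `k`. -/
abbrev past {Ω : Type*} {n d : ℕ} (M : ℕ) (J : ℕ → Ω → Option (Fin n))
    (G : ℕ → Fin n → ℕ → Ω → EuclideanSpace ℝ (Fin d)) (k : ℕ) : MeasurableSpace Ω :=
  eventHistory J k ⊔ gradHistory M G (k + 1)

/-- Everything that has happened when client `i` calls its stochastic gradient at local step `m` of
the local training started at iteration `k`. -/
abbrev pastCall {Ω : Type*} {n d : ℕ} (M : ℕ) (J : ℕ → Ω → Option (Fin n))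
    (G : ℕ → Fin n → ℕ → Ω → EuclideanSpace ℝ (Fin d)) (k : ℕ) (i : Fin n) (m : ℕ) :
    MeasurableSpace Ω :=
  eventHistory J k ⊔ gradHistory M G k ⊔
    ⨆ l ∈ Finset.range m, MeasurableSpace.comap (G k i l) inferInstance

/-- The stochastic gradient error of the call `(k, i, m)`: the realised stochastic gradient minus
the gradient of `f i` at the point of the call. -/
noncomputable def noise {Ω : Type*} {n d : ℕ} (f : Fin n → EuclideanSpace ℝ (Fin d) → ℝ) (M : ℕ)
    (α : ℕ → ℝ) (x₀ : EuclideanSpace ℝ (Fin d)) (J : ℕ → Ω → Option (Fin n))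
    (G : ℕ → Fin n → ℕ → Ω → EuclideanSpace ℝ (Fin d)) (k : ℕ) (i : Fin n) (m : ℕ) (ω : Ω) :
    EuclideanSpace ℝ (Fin d) :=
  G k i m ω - gradient (f i)
    (localPoint M α x₀ (fun l => J l ω) (fun l i' m' => G l i' m' ω) k i m)

/-- The probabilistic assumptions: the event of each iteration is independent of the past and has
the stationary probabilities `p i`, `ps` (so the events are IID), and the stochastic gradients are
conditionally unbiased with conditional variance at most `σ ^ 2`. -/
structure StochasticModel {Ω : Type*} [MeasurableSpace Ω] (P : Measure Ω) {n d : ℕ}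
    (f : Fin n → EuclideanSpace ℝ (Fin d) → ℝ) (σ : ℝ) (p : Fin n → ℝ) (ps : ℝ) (M : ℕ)
    (α : ℕ → ℝ) (x₀ : EuclideanSpace ℝ (Fin d)) (J : ℕ → Ω → Option (Fin n))
    (G : ℕ → Fin n → ℕ → Ω → EuclideanSpace ℝ (Fin d)) : Prop where
  measurable_event : ∀ k, Measurable[inferInstance, ⊤] (J k)
  prob_client : ∀ k i, P (J (k + 1) ⁻¹' {some i}) = ENNReal.ofReal (p i)
  prob_server : ∀ k, P (J (k + 1) ⁻¹' {none}) = ENNReal.ofReal ps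
  indep_event : ∀ k, Indep (MeasurableSpace.comap (J (k + 1)) ⊤) (past M J G k) P
  measurable_grad : ∀ k i m, Measurable (G k i m)
  integrable_noise : ∀ k i, ∀ m < M, Integrable (fun ω => ‖noise f M α x₀ J G k i m ω‖ ^ 2) P
  unbiased : ∀ k i, ∀ m < M, P[noise f M α x₀ J G k i m | pastCall M J G k i m] =ᵐ[P] 0
  variance_le : ∀ k i, ∀ m < M,
    P[fun ω => ‖noise f M α x₀ J G k i m ω‖ ^ 2 | pastCall M J G k i m] ≤ᵐ[P] fun _ => σ ^ 2

/-! ### The objective and the constants -/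

/-- `f` has an `L`-Lipschitz gradient. -/
def IsSmooth {d : ℕ} (L : ℝ) (f : EuclideanSpace ℝ (Fin d) → ℝ) : Prop :=
  Differentiable ℝ f ∧ ∀ x y, ‖gradient f x - gradient f y‖ ≤ L * ‖x - y‖

/-- Strong convexity of a differentiable function. -/
def IsStronglyConvex {d : ℕ} (μ : ℝ) (f : EuclideanSpace ℝ (Fin d) → ℝ) : Prop :=
  ∀ x y, f x + inner ℝ (gradient f x) (y - x) + μ / 2 * ‖y - x‖ ^ 2 ≤ f y

/-- The global loss `f = (1/n) ∑ f_i`. -/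
noncomputable def globalLoss {n d : ℕ} (f : Fin n → EuclideanSpace ℝ (Fin d) → ℝ)
    (x : EuclideanSpace ℝ (Fin d)) : ℝ :=
  1 / (n : ℝ) * ∑ i, f i x

/-- `p_min = min {min_i p_i, p_s}`. -/
noncomputable def pMin {n : ℕ} (p : Fin n → ℝ) (ps : ℝ) : ℝ := min (⨅ i, p i) ps

/-- `q̄ = (1/n) ∑ 1/p_i`. -/
noncomputable def qBar {n : ℕ} (p : Fin n → ℝ) : ℝ := 1 / (n : ℝ) * ∑ i, 1 / p i

/-- `ζ = max_i ‖x⋆ - u_i⋆‖`. -/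
noncomputable def heterogeneity {n d : ℕ} (xstar : EuclideanSpace ℝ (Fin d))
    (u : Fin n → EuclideanSpace ℝ (Fin d)) : ℝ :=
  ⨆ i, ‖xstar - u i‖

/-- `γ = 2μL/(μ+L)`. -/
noncomputable def gam (μ L : ℝ) : ℝ := 2 * μ * L / (μ + L)

/-- The bound `𝒟` on the step sizes. For `M = 1` the last three members of the minimum have
denominator zero and count as `+∞`. -/
noncomputable def stepBound (M : ℕ) (μ L : ℝ) : ℝ :=
  if M = 1 then 2 / (M * (μ + L))
  else
    min (min (2 / (M * (μ + L))) (gam μ L / (L ^ 2 * ((M : ℝ) - 1))))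
      (min (Real.sqrt (M * gam μ L ^ 2 / (64 * L ^ 4 * ((M : ℝ) - 1) ^ 3)))
        ((gam μ L / (32 * L ^ 4 * ((M : ℝ) - 1) ^ 3)) ^ (1 / 3 : ℝ)))

/-- The step sizes `α_k = 1 / (p_min M γ k / 48 + 1 / 𝒟)`. -/
noncomputable def stepSize {n : ℕ} (p : Fin n → ℝ) (ps : ℝ) (M : ℕ) (μ L : ℝ) (k : ℕ) : ℝ :=
  1 / (pMin p ps * M * gam μ L * k / 48 + 1 / stepBound M μ L)

/-- The rate, with `r_p = p_s / p_min`, `κ = L / μ` and `δ = 1 - 1 / M`. -/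
noncomputable def rate {n : ℕ} (p : Fin n → ℝ) (ps : ℝ) (M : ℕ) (μ L σ ζ : ℝ) (K : ℕ) : ℝ :=
  let pm : ℝ := pMin p ps
  let rp : ℝ := ps / pm
  let q : ℝ := qBar p
  let κ : ℝ := L / μ
  let δ : ℝ := 1 - 1 / (M : ℝ)
  rp * (1 + δ * κ) * σ ^ 2 / (pm * M * K)
    + rp * Real.sqrt q * L * Real.sqrt (1 + δ * κ) * σ * ζ
        / (pm * Real.sqrt M * (K : ℝ) ^ (3 / 2 : ℝ))
    + rp * Real.sqrt q * L ^ (3 / 2 : ℝ) * Real.sqrt (σ * ζ ^ 3)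
        / (Real.sqrt pm * (K : ℝ) ^ (3 / 2 : ℝ))
    + rp * (δ + Real.sqrt pm * q) * L ^ 4 * ζ ^ 2 / (pm ^ 2 * (K : ℝ) ^ 2)

end AREA

/-!
The aggregator keeps the invariant that model plus aggregator is the average of the client memories
(`xs_add_us_eq_average`), so an aggregation replaces the server model by that average. Information
thus circulates in three stages: local training turns the server model into a local result, a
message moves the local result into the memory, an aggregation averages the memories into the
server model. Only local training contracts; the other two stages copy or average.

The clients' results are compared with the points `target i = x⋆ - M a ∇f_i(x⋆)`. They average to
`x⋆`, because the client gradients cancel there, and local training from `x` ends near `target i`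
up to a contraction of `‖x - x⋆‖`, the noise, and a drift of order `a² M (M - 1) L² ζ`
(`StochasticModel.setIntegral_randomPoint_sub_linear_le`). For `a` the *current* step size is used
for all clients, however old their results are. The staleness of the results then never has to be
tracked: its only effect is that the targets move a little whenever the step size changes.

Since each event is independent of the past, the mean square errors of the three stages satisfy a
linear recursion. A Lyapunov function (`lyapunov`) weighs each error by the inverse of the rate at
which it is refreshed, and gives the stages slightly increasing weights, so that the contraction of
the training is shared out equally; it decreases by a factor `1 - c p_min M μ a` per iteration
(`lyapunov_succ_le`). Together with the cost of noise, drift and target motion this gives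
`V k ≤ (1 - 4 / k) V (k - 1) + A / k² + B / k³` (`StochasticModel.energy_succ_le` and
`decrease_le_of_stepSize`), hence `V k ≤ A / (3 k) + B / (2 k²) + O(k⁻³)` (`le_of_contraction`).
The `A` part is bounded by the first term of the rate and the `B` part by the last one. The
transient of order `k⁻³` comes from the iterations before the step sizes are small; a crude bound
(`crudeBound`) controls it by `max σ ζ ^ 2`, with a factor that depends only on what the threshold
may depend on, so it is eventually dominated by the same two terms.
-/

namespace AREA

/-! ### Elementary inequalities -/

/-- Young's inequality for the square of a norm. -/
theorem norm_add_sq_le_young {E : Type*} [SeminormedAddCommGroup E] {ε : ℝ} (hε : 0 < ε) (a b : E) :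
    ‖a + b‖ ^ 2 ≤ (1 + ε) * ‖a‖ ^ 2 + (1 + 1 / ε) * ‖b‖ ^ 2 := by
  have h1 : ‖a + b‖ ^ 2 ≤ (‖a‖ + ‖b‖) ^ 2 := by
    gcongr
    exact norm_add_le a b
  have h2 : 0 ≤ (ε * ‖a‖ - ‖b‖) ^ 2 / ε := by positivity
  have h3 : (ε * ‖a‖ - ‖b‖) ^ 2 / ε = ε * ‖a‖ ^ 2 - 2 * ‖a‖ * ‖b‖ + 1 / ε * ‖b‖ ^ 2 := by
    field_simp
    ring
  nlinarith

/-- Jensen's inequality for the squared norm of an average. -/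
theorem norm_average_sq_le {E : Type*} [SeminormedAddCommGroup E] [NormedSpace ℝ E] {n : ℕ}
    (hn : 0 < n) (v : Fin n → E) :
    ‖(1 / (n : ℝ)) • ∑ i, v i‖ ^ 2 ≤ 1 / (n : ℝ) * ∑ i, ‖v i‖ ^ 2 := by
  have hn' : (0 : ℝ) < n := by exact_mod_cast hn
  have h1 : ‖∑ i, v i‖ ^ 2 ≤ (∑ i, ‖v i‖) ^ 2 := by
    gcongr
    exact norm_sum_le _ _
  have h2 := sq_sum_le_card_mul_sum_sq (s := Finset.univ) (f := fun i => ‖v i‖)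
  rw [Finset.card_univ, Fintype.card_fin] at h2
  rw [norm_smul, mul_pow, Real.norm_of_nonneg (by positivity)]
  calc (1 / (n : ℝ)) ^ 2 * ‖∑ i, v i‖ ^ 2
      ≤ (1 / (n : ℝ)) ^ 2 * (n * ∑ i, ‖v i‖ ^ 2) := by
        gcongr
        exact h1.trans h2
    _ = 1 / (n : ℝ) * ∑ i, ‖v i‖ ^ 2 := by field_simp

theorem one_sub_pow_le {t : ℝ} (h0 : 0 ≤ t) (h1 : t ≤ 1) (m : ℕ) :
    (1 - t) ^ m ≤ 1 - m * t + (m * t) ^ 2 / 2 := by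
  induction m with
  | zero => simp
  | succ m ih =>
    have h := mul_le_mul_of_nonneg_right ih (sub_nonneg.2 h1)
    have hm : (0 : ℝ) ≤ m := m.cast_nonneg
    rw [pow_succ]
    push_cast
    nlinarith [mul_nonneg (mul_nonneg hm hm) (pow_nonneg h0 3), sq_nonneg t]

/-! ### Gradient descent on a smooth strongly convex function -/

section Geometry

variable {d : ℕ} {f : EuclideanSpace ℝ (Fin d) → ℝ} {μ L : ℝ}

theorem IsStronglyConvex.mul_norm_sub_sq_le_inner (hf : IsStronglyConvex μ f)
    (x y : EuclideanSpace ℝ (Fin d)) :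
    μ * ‖x - y‖ ^ 2 ≤ inner ℝ (gradient f x - gradient f y) (x - y) := by
  have h1 := hf x y
  have h2 := hf y x
  have h3 : y - x = -(x - y) := by abel
  rw [h3, inner_neg_right, norm_neg] at h1
  rw [inner_sub_left]
  linarith

theorem IsSmooth.continuous_gradient (hf : IsSmooth L f) : Continuous (gradient f) := by
  have : LipschitzWith L.toNNReal (gradient f) := by
    refine LipschitzWith.of_dist_le_mul fun x y => ?_
    rw [dist_eq_norm, dist_eq_norm]
    refine (hf.2 x y).trans ?_
    gcongr
    exact Real.le_coe_toNNReal L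
  exact this.continuous

/-- In a nontrivial space the strong convexity constant is at most the smoothness constant. -/
theorem IsStronglyConvex.subsingleton_or_le (hf : IsStronglyConvex μ f) (hs : IsSmooth L f) :
    Subsingleton (EuclideanSpace ℝ (Fin d)) ∨ μ ≤ L := by
  rcases subsingleton_or_nontrivial (EuclideanSpace ℝ (Fin d)) with h | h
  · exact Or.inl h
  · right
    obtain ⟨x, y, hxy⟩ := exists_pair_ne (EuclideanSpace ℝ (Fin d))
    have hpos : 0 < ‖x - y‖ := norm_pos_iff.2 (sub_ne_zero.2 hxy)
    have h1 := (hf.mul_norm_sub_sq_le_inner x y).trans (real_inner_le_norm _ _)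
    have h2 := mul_le_mul_of_nonneg_right (hs.2 x y) hpos.le
    have h3 : μ * ‖x - y‖ ^ 2 ≤ L * ‖x - y‖ ^ 2 := by linarith
    exact le_of_mul_le_mul_right h3 (by positivity)

/-- A gradient step contracts squared distances by the factor `1 - 2 a μ + a² L²`. -/
theorem norm_gradStep_sub_sq_le (hs : IsSmooth L f) (hc : IsStronglyConvex μ f) {a : ℝ}
    (ha : 0 ≤ a) (x y : EuclideanSpace ℝ (Fin d)) :
    ‖(x - a • gradient f x) - (y - a • gradient f y)‖ ^ 2
      ≤ (1 - 2 * a * μ + a ^ 2 * L ^ 2) * ‖x - y‖ ^ 2 := by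
  have h1 : (x - a • gradient f x) - (y - a • gradient f y)
      = (x - y) - a • (gradient f x - gradient f y) := by
    rw [smul_sub]
    abel
  have h2 : ‖gradient f x - gradient f y‖ ^ 2 ≤ (L * ‖x - y‖) ^ 2 := by
    gcongr
    exact hs.2 x y
  have h3 := hc.mul_norm_sub_sq_le_inner x y
  rw [h1, norm_sub_sq_real, inner_smul_right, norm_smul, mul_pow, Real.norm_of_nonneg ha,
    real_inner_comm]
  have h4 := mul_le_mul_of_nonneg_left h2 (sq_nonneg a)
  have h5 := mul_le_mul_of_nonneg_left h3 ha
  nlinarith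

theorem gradient_eq_zero_of_isMinOn {u : EuclideanSpace ℝ (Fin d)}
    (hu : IsMinOn f Set.univ u) : gradient f u = 0 := by
  have h : fderiv ℝ f u = 0 := (hu.isLocalMin Filter.univ_mem).fderiv_eq_zero
  rw [gradient, h, map_zero]

/-- Gradient descent with constant step size `a` from `x`. -/
noncomputable def gdPath (f : EuclideanSpace ℝ (Fin d) → ℝ) (a : ℝ)
    (x : EuclideanSpace ℝ (Fin d)) : ℕ → EuclideanSpace ℝ (Fin d)
  | 0 => x
  | m + 1 => gdPath f a x m - a • gradient f (gdPath f a x m)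

/-- The displacement of gradient descent after `m` steps, when a single step is nonexpansive. -/
theorem norm_gdPath_sub_le (hs : IsSmooth L f) (hc : IsStronglyConvex μ f) {a : ℝ}
    (ha : 0 ≤ a) (haL : a * L ^ 2 ≤ 2 * μ) (x : EuclideanSpace ℝ (Fin d)) (m : ℕ) :
    ‖gdPath f a x m - x‖ ≤ m * (a * ‖gradient f x‖) := by
  induction m with
  | zero => simp [gdPath]
  | succ m ih =>
    set z := gdPath f a x m
    have h1 : gdPath f a x (m + 1) - x
        = ((z - a • gradient f z) - (x - a • gradient f x)) - a • gradient f x := by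
      simp only [gdPath]
      abel
    have h2 : ‖(z - a • gradient f z) - (x - a • gradient f x)‖ ≤ ‖z - x‖ := by
      refine (sq_le_sq₀ (norm_nonneg _) (norm_nonneg _)).1
        ((norm_gradStep_sub_sq_le hs hc ha z x).trans ?_)
      have : 1 - 2 * a * μ + a ^ 2 * L ^ 2 ≤ 1 := by nlinarith
      nlinarith [sq_nonneg ‖z - x‖]
    rw [h1]
    refine (norm_sub_le _ _).trans ?_
    rw [norm_smul, Real.norm_of_nonneg ha]
    push_cast
    linarith

/-- `M` gradient steps from `x` differ from one step of length `M a` along the initial gradient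
only to second order in `a`. -/
theorem norm_gdPath_sub_linear_le (hs : IsSmooth L f) (hc : IsStronglyConvex μ f) {a : ℝ}
    (ha : 0 ≤ a) (hL : 0 ≤ L) (haL : a * L ^ 2 ≤ 2 * μ) (x : EuclideanSpace ℝ (Fin d)) (m : ℕ) :
    ‖gdPath f a x m - (x - (m * a) • gradient f x)‖
      ≤ a ^ 2 * L * ‖gradient f x‖ * (m * (m - 1) / 2) := by
  induction m with
  | zero => simp [gdPath]
  | succ m ih =>
    set z := gdPath f a x m with hz
    have h1 : gdPath f a x (m + 1) - (x - ((m + 1 : ℕ) * a) • gradient f x)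
        = (z - (x - (m * a) • gradient f x)) - a • (gradient f z - gradient f x) := by
      simp only [gdPath, Nat.cast_add, Nat.cast_one, add_mul, one_mul, add_smul, smul_sub]
      abel
    have h2 : ‖gradient f z - gradient f x‖ ≤ L * (m * (a * ‖gradient f x‖)) :=
      (hs.2 z x).trans (mul_le_mul_of_nonneg_left (norm_gdPath_sub_le hs hc ha haL x m) hL)
    rw [h1]
    refine (norm_sub_le _ _).trans ?_
    rw [norm_smul, Real.norm_of_nonneg ha]
    have h3 := mul_le_mul_of_nonneg_left h2 ha
    push_cast
    nlinarith

end Geometry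

/-! ### The finite-sum objective -/

section Objective

variable {n d : ℕ} {f : Fin n → EuclideanSpace ℝ (Fin d) → ℝ} {L : ℝ}

/-- The client gradients cancel at the minimizer of the global loss. -/
theorem sum_gradient_eq_zero (hn : 0 < n) (hs : ∀ i, IsSmooth L (f i))
    {xstar : EuclideanSpace ℝ (Fin d)} (hx : IsMinOn (globalLoss f) Set.univ xstar) :
    ∑ i, gradient (f i) xstar = 0 := by
  have h0 : HasFDerivAt (globalLoss f) ((1 / (n : ℝ)) • ∑ i, fderiv ℝ (f i) xstar) xstar := by
    have := (HasFDerivAt.fun_sum (u := Finset.univ)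
      fun i _ => ((hs i).1 xstar).hasFDerivAt).const_mul (1 / (n : ℝ))
    exact this
  have h1 : (1 / (n : ℝ)) • ∑ i, fderiv ℝ (f i) xstar = 0 :=
    (hx.isLocalMin Filter.univ_mem).hasFDerivAt_eq_zero h0
  have hn' : (1 / (n : ℝ)) ≠ 0 := by positivity
  have h2 := (smul_eq_zero.1 h1).resolve_left hn'
  simp only [gradient]
  rw [← map_sum, h2, map_zero]

theorem heterogeneity_nonneg (xstar : EuclideanSpace ℝ (Fin d))
    (u : Fin n → EuclideanSpace ℝ (Fin d)) : 0 ≤ heterogeneity xstar u :=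
  Real.iSup_nonneg fun _ => norm_nonneg _

theorem norm_gradient_le_heterogeneity (hL : 0 ≤ L) (hs : ∀ i, IsSmooth L (f i))
    (xstar : EuclideanSpace ℝ (Fin d)) {u : Fin n → EuclideanSpace ℝ (Fin d)}
    (hu : ∀ i, IsMinOn (f i) Set.univ (u i)) (i : Fin n) :
    ‖gradient (f i) xstar‖ ≤ L * heterogeneity xstar u := by
  have h := (hs i).2 xstar (u i)
  rw [gradient_eq_zero_of_isMinOn (hu i), sub_zero] at h
  refine h.trans (mul_le_mul_of_nonneg_left ?_ hL)
  exact le_ciSup (f := fun i => ‖xstar - u i‖) (Set.finite_range _).bddAbove i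

end Objective

/-! ### The server aggregates the client memories -/

section Pathwise

variable {n d M : ℕ} {α : ℕ → ℝ} {x₀ : EuclideanSpace ℝ (Fin d)} {j : ℕ → Option (Fin n)}
  {g : ℕ → Fin n → ℕ → EuclideanSpace ℝ (Fin d)}

theorem xs_add_us_eq_average (hn : 0 < n) (k : ℕ) :
    (iterate M α x₀ j g k).xs + (iterate M α x₀ j g k).us
      = (1 / (n : ℝ)) • ∑ i, (iterate M α x₀ j g k).y i := by
  have hn' : (n : ℝ) ≠ 0 := by positivity
  induction k with
  | zero =>
    simp only [iterate, Finset.sum_const, Finset.card_univ, Fintype.card_fin, add_zero]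
    rw [← Nat.cast_smul_eq_nsmul ℝ, smul_smul, one_div_mul_cancel hn', one_smul]
  | succ k ih =>
    simp only [iterate]
    set S := iterate M α x₀ j g k
    cases j (k + 1) with
    | none => simpa only [step, add_zero] using ih
    | some i =>
      simp only [step]
      have h : ∑ i', Function.update S.y i (S.loc i) i' = ∑ i', S.y i' + (S.loc i - S.y i) := by
        rw [Finset.sum_update_of_mem (Finset.mem_univ i),
          ← Finset.add_sum_erase _ S.y (Finset.mem_univ i), Finset.sdiff_singleton_eq_erase]
        abel
      rw [h, smul_add, ← ih, add_assoc]

theorem iterate_succ_xs (hn : 0 < n) (k : ℕ) :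
    (iterate M α x₀ j g (k + 1)).xs =
      if j (k + 1) = none then (1 / (n : ℝ)) • ∑ i, (iterate M α x₀ j g k).y i
      else (iterate M α x₀ j g k).xs := by
  rw [← xs_add_us_eq_average hn k]
  simp only [iterate]
  cases j (k + 1) <;> simp [step]

theorem iterate_succ_y (k : ℕ) (i : Fin n) :
    (iterate M α x₀ j g (k + 1)).y i =
      if j (k + 1) = some i then (iterate M α x₀ j g k).loc i
      else (iterate M α x₀ j g k).y i := by
  simp only [iterate]
  cases h : j (k + 1) with
  | none => simp [step]
  | some i' =>
    by_cases hi : i = i'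
    · subst hi
      simp [step]
    · simp [step, Function.update_of_ne hi, Ne.symm hi]

theorem iterate_succ_loc (k : ℕ) (i : Fin n) :
    (iterate M α x₀ j g (k + 1)).loc i =
      if j (k + 1) = some i then localPoint M α x₀ j g (k + 1) i M
      else (iterate M α x₀ j g k).loc i := by
  simp only [iterate, localPoint, handedOut]
  cases h : j (k + 1) with
  | none => simp [step]
  | some i' =>
    by_cases hi : i = i'
    · subst hi
      simp [step]
    · simp [step, Function.update_of_ne hi, Ne.symm hi]

end Pathwise

/-! ### Measurability and square integrability of the iterates -/

section Stochastic

variable {Ω : Type*} {n d : ℕ}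

/-- The random state of the algorithm after `k` iterations. -/
noncomputable abbrev randomState (M : ℕ) (α : ℕ → ℝ) (x₀ : EuclideanSpace ℝ (Fin d))
    (J : ℕ → Ω → Option (Fin n)) (G : ℕ → Fin n → ℕ → Ω → EuclideanSpace ℝ (Fin d)) (k : ℕ)
    (ω : Ω) : State n d :=
  iterate M α x₀ (fun l => J l ω) (fun l i m => G l i m ω) k

/-- The random local iterate number `m` of client `i` in the training started at iteration `k`. -/
noncomputable abbrev randomPoint (M : ℕ) (α : ℕ → ℝ) (x₀ : EuclideanSpace ℝ (Fin d))
    (J : ℕ → Ω → Option (Fin n)) (G : ℕ → Fin n → ℕ → Ω → EuclideanSpace ℝ (Fin d)) (k : ℕ)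
    (i : Fin n) (m : ℕ) (ω : Ω) : EuclideanSpace ℝ (Fin d) :=
  localPoint M α x₀ (fun l => J l ω) (fun l i m => G l i m ω) k i m

variable {M : ℕ} {α : ℕ → ℝ} {x₀ : EuclideanSpace ℝ (Fin d)} {J : ℕ → Ω → Option (Fin n)}
  {G : ℕ → Fin n → ℕ → Ω → EuclideanSpace ℝ (Fin d)}

theorem eventHistory_mono {k l : ℕ} (h : k ≤ l) : eventHistory J k ≤ eventHistory J l :=
  biSup_mono fun _ hm => Finset.Icc_subset_Icc_right h hm

theorem gradHistory_mono {k l : ℕ} (h : k ≤ l) : gradHistory M G k ≤ gradHistory M G l :=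
  biSup_mono fun _ hm => Finset.range_mono h hm

theorem past_mono {k l : ℕ} (h : k ≤ l) : past M J G k ≤ past M J G l :=
  sup_le_sup (eventHistory_mono h) (gradHistory_mono (Nat.succ_le_succ h))

theorem measurable_event_of_history {k l : ℕ} (h1 : 1 ≤ l) (h : l ≤ k) :
    Measurable[eventHistory J k, ⊤] (J l) := by
  rw [measurable_iff_comap_le]
  exact le_iSup₂_of_le (f := fun l (_ : l ∈ Finset.Icc 1 k) => MeasurableSpace.comap (J l) ⊤) l
    (Finset.mem_Icc.2 ⟨h1, h⟩) le_rfl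

theorem measurableSet_event_of_history {k l : ℕ} (h1 : 1 ≤ l) (h : l ≤ k)
    (e : Option (Fin n)) : MeasurableSet[eventHistory J k] {ω | J l ω = e} :=
  measurable_event_of_history h1 h (t := {e}) trivial

theorem measurable_grad_of_history {k l m : ℕ} (h : l < k) (i : Fin n) (hm : m < M) :
    Measurable[gradHistory M G k] (G l i m) := by
  rw [measurable_iff_comap_le]
  refine le_iSup₂_of_le (f := fun l (_ : l ∈ Finset.range k) => ⨆ i : Fin n,
    ⨆ m ∈ Finset.range M, MeasurableSpace.comap (G l i m) inferInstance) l
    (Finset.mem_range.2 h) ?_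
  refine le_iSup_of_le (f := fun i : Fin n => ⨆ m ∈ Finset.range M,
    MeasurableSpace.comap (G l i m) inferInstance) i ?_
  exact le_iSup₂_of_le (f := fun m (_ : m ∈ Finset.range M) =>
    MeasurableSpace.comap (G l i m) inferInstance) m (Finset.mem_range.2 hm) le_rfl

theorem measurable_grad_of_pastCall {k l m : ℕ} (i : Fin n) (h : l < m) :
    Measurable[pastCall M J G k i m] (G k i l) := by
  rw [measurable_iff_comap_le]
  refine le_trans ?_ le_sup_right
  exact le_iSup₂_of_le (f := fun l (_ : l ∈ Finset.range m) =>
    MeasurableSpace.comap (G k i l) inferInstance) l (Finset.mem_range.2 h) le_rfl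

theorem measurable_localSGD {m' : MeasurableSpace Ω} {a : ℝ} {x : Ω → EuclideanSpace ℝ (Fin d)}
    {g : ℕ → Ω → EuclideanSpace ℝ (Fin d)} {m : ℕ} (hx : Measurable x)
    (hg : ∀ l < m, Measurable (g l)) :
    Measurable fun ω => localSGD a (x ω) (fun l => g l ω) m := by
  induction m with
  | zero => simpa only [localSGD] using hx
  | succ m ih =>
    simp only [localSGD]
    exact (ih fun l hl => hg l (hl.trans (Nat.lt_succ_self m))).sub
      ((hg m (Nat.lt_succ_self m)).const_smul a)

/-- The state after iteration `k` is determined by the past of that iteration. -/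
theorem measurable_randomState (hn : 0 < n) (k : ℕ) :
    Measurable[past M J G k] (fun ω => (randomState M α x₀ J G k ω).xs) ∧
    (∀ i, Measurable[past M J G k] fun ω => (randomState M α x₀ J G k ω).y i) ∧
    (∀ i, Measurable[past M J G k] fun ω => (randomState M α x₀ J G k ω).loc i) := by
  induction k with
  | zero =>
    refine ⟨measurable_const, fun i => measurable_const, fun i => ?_⟩
    simp only [iterate]
    exact measurable_localSGD (m' := past M J G 0) measurable_const fun l hl =>
      (measurable_grad_of_history (Nat.zero_lt_one) i hl).mono le_sup_right le_rfl
  | succ k ih =>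
    have hset : ∀ e, MeasurableSet[past M J G (k + 1)] {ω | J (k + 1) ω = e} := fun e =>
      le_sup_left (a := eventHistory J (k + 1)) _
        (measurableSet_event_of_history (Nat.succ_le_succ (Nat.zero_le k)) le_rfl e)
    have hle : past M J G k ≤ past M J G (k + 1) := past_mono (Nat.le_succ k)
    have hx := ih.1.mono hle le_rfl
    have hy := fun i => (ih.2.1 i).mono hle le_rfl
    have hl := fun i => (ih.2.2 i).mono hle le_rfl
    refine ⟨?_, fun i => ?_, fun i => ?_⟩
    · simp only [randomState, iterate_succ_xs hn]
      refine @Measurable.ite _ _ _ _ (past M J G (k + 1)) _ _ _ (hset none) ?_ hx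
      have hsum : Measurable[past M J G (k + 1)]
          fun ω => ∑ i, (randomState M α x₀ J G k ω).y i :=
        Finset.measurable_fun_sum _ fun i _ => hy i
      exact hsum.const_smul (1 / (n : ℝ))
    · simp only [randomState, iterate_succ_y]
      exact @Measurable.ite _ _ _ _ (past M J G (k + 1)) _ _ _ (hset (some i)) (hl i) (hy i)
    · simp only [randomState, iterate_succ_loc]
      refine @Measurable.ite _ _ _ _ (past M J G (k + 1)) _ _ _ (hset (some i)) ?_ (hl i)
      simp only [localPoint, handedOut]
      exact measurable_localSGD (m' := past M J G (k + 1)) hx fun l hl =>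
        (measurable_grad_of_history (Nat.lt_succ_self (k + 1)) i hl).mono le_sup_right le_rfl

theorem measurable_randomPoint (hn : 0 < n) (k : ℕ) (i : Fin n) (m : ℕ) :
    Measurable[pastCall M J G k i m] (randomPoint M α x₀ J G k i m) := by
  refine measurable_localSGD (m' := pastCall M J G k i m) (a := α k) ?_ fun l hl =>
    measurable_grad_of_pastCall i hl
  cases k with
  | zero => exact measurable_const
  | succ k =>
    refine (measurable_randomState hn k).1.mono (le_trans ?_ le_sup_left) le_rfl
    exact sup_le_sup (eventHistory_mono (Nat.le_succ k)) le_rfl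

/-- A local step is a gradient step perturbed by the noise. -/
theorem randomPoint_succ (f : Fin n → EuclideanSpace ℝ (Fin d) → ℝ) (k : ℕ) (i : Fin n) (m : ℕ)
    (ω : Ω) :
    randomPoint M α x₀ J G k i (m + 1) ω
      = (randomPoint M α x₀ J G k i m ω - α k • gradient (f i) (randomPoint M α x₀ J G k i m ω))
        - α k • noise f M α x₀ J G k i m ω := by
  simp only [noise, smul_sub, randomPoint]
  conv_lhs => rw [localPoint, localSGD]
  rw [← localPoint]
  abel

variable [mΩ : MeasurableSpace Ω] {P : Measure Ω} {f : Fin n → EuclideanSpace ℝ (Fin d) → ℝ}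
  {σ ps : ℝ} {p : Fin n → ℝ}

theorem StochasticModel.eventHistory_le (h : StochasticModel P f σ p ps M α x₀ J G) (k : ℕ) :
    eventHistory J k ≤ mΩ :=
  iSup₂_le fun l _ => (h.measurable_event l).comap_le

theorem StochasticModel.gradHistory_le (h : StochasticModel P f σ p ps M α x₀ J G) (k : ℕ) :
    gradHistory M G k ≤ mΩ :=
  iSup₂_le fun l _ => iSup_le fun i => iSup₂_le fun m _ => (h.measurable_grad l i m).comap_le

theorem StochasticModel.past_le (h : StochasticModel P f σ p ps M α x₀ J G) (k : ℕ) :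
    past M J G k ≤ mΩ :=
  sup_le (h.eventHistory_le k) (h.gradHistory_le _)

theorem StochasticModel.pastCall_le (h : StochasticModel P f σ p ps M α x₀ J G) (k : ℕ)
    (i : Fin n) (m : ℕ) : pastCall M J G k i m ≤ mΩ :=
  sup_le (sup_le (h.eventHistory_le k) (h.gradHistory_le _))
    (iSup₂_le fun l _ => (h.measurable_grad k i l).comap_le)

theorem StochasticModel.measurableSet_event (h : StochasticModel P f σ p ps M α x₀ J G) (k : ℕ)
    (e : Option (Fin n)) : MeasurableSet {ω | J k ω = e} :=
  h.measurable_event k (t := {e}) trivial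

theorem StochasticModel.measurable_noise (h : StochasticModel P f σ p ps M α x₀ J G)
    (hn : 0 < n) {L : ℝ} (hs : ∀ i, IsSmooth L (f i)) (k : ℕ) (i : Fin n) (m : ℕ) :
    Measurable (noise f M α x₀ J G k i m) :=
  (h.measurable_grad k i m).sub ((hs i).continuous_gradient.measurable.comp
    ((measurable_randomPoint hn k i m).mono (h.pastCall_le k i m) le_rfl))

theorem StochasticModel.memLp_noise (h : StochasticModel P f σ p ps M α x₀ J G)
    (hn : 0 < n) {L : ℝ} (hs : ∀ i, IsSmooth L (f i)) (k : ℕ) (i : Fin n) {m : ℕ} (hm : m < M) :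
    MemLp (noise f M α x₀ J G k i m) 2 P :=
  (memLp_two_iff_integrable_sq_norm (h.measurable_noise hn hs k i m).aestronglyMeasurable).2
    (h.integrable_noise k i m hm)

theorem integrable_norm_sub_sq [IsFiniteMeasure P] {F : Ω → EuclideanSpace ℝ (Fin d)}
    (hF : MemLp F 2 P) (r : EuclideanSpace ℝ (Fin d)) :
    Integrable (fun ω => ‖F ω - r‖ ^ 2) P :=
  (hF.sub (memLp_const r)).integrable_norm_pow two_ne_zero

theorem IsSmooth.memLp_gradient [IsFiniteMeasure P] {f : EuclideanSpace ℝ (Fin d) → ℝ} {L : ℝ}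
    (hs : IsSmooth L f) {F : Ω → EuclideanSpace ℝ (Fin d)} (hF : MemLp F 2 P) :
    MemLp (fun ω => gradient f (F ω)) 2 P := by
  have h1 : MemLp (fun ω => gradient f (F ω) - gradient f 0) 2 P := by
    refine MemLp.of_le_mul (c := L) hF ?_ (Filter.Eventually.of_forall fun ω => ?_)
    · exact (hs.continuous_gradient.comp_aestronglyMeasurable hF.1).sub
        aestronglyMeasurable_const
    · simpa using hs.2 (F ω) 0
  have h2 := h1.add (memLp_const (gradient f 0))
  convert h2 using 1
  funext ω
  simp

theorem memLp_ite {s : Ω → Prop} [DecidablePred s] (hs : MeasurableSet {ω | s ω})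
    {A B : Ω → EuclideanSpace ℝ (Fin d)} (hA : MemLp A 2 P) (hB : MemLp B 2 P) :
    MemLp (fun ω => if s ω then A ω else B ω) 2 P := by
  have h := (hA.indicator hs).add (hB.indicator hs.compl)
  convert h using 1
  funext ω
  by_cases hω : s ω <;> simp [hω]

variable [IsProbabilityMeasure P]

theorem StochasticModel.memLp_randomPoint_of_start (h : StochasticModel P f σ p ps M α x₀ J G)
    (hn : 0 < n) {L : ℝ} (hs : ∀ i, IsSmooth L (f i)) {k : ℕ} (i : Fin n)
    (h0 : MemLp (randomPoint M α x₀ J G k i 0) 2 P) {m : ℕ} (hm : m ≤ M) :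
    MemLp (randomPoint M α x₀ J G k i m) 2 P := by
  induction m with
  | zero => exact h0
  | succ m ih =>
    have hp := ih (Nat.le_of_succ_le hm)
    have := (hp.sub (((hs i).memLp_gradient hp).const_smul (α k))).sub
      ((h.memLp_noise hn hs k i hm).const_smul (α k))
    refine this.congr_norm ?_ (Filter.Eventually.of_forall fun ω => ?_)
    · exact ((measurable_randomPoint hn k i _).mono
        (h.pastCall_le k i _) le_rfl).aestronglyMeasurable
    · rw [randomPoint_succ f]
      rfl

theorem StochasticModel.memLp_randomState (h : StochasticModel P f σ p ps M α x₀ J G)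
    (hn : 0 < n) {L : ℝ} (hs : ∀ i, IsSmooth L (f i)) (k : ℕ) :
    MemLp (fun ω => (randomState M α x₀ J G k ω).xs) 2 P ∧
    (∀ i, MemLp (fun ω => (randomState M α x₀ J G k ω).y i) 2 P) ∧
    (∀ i, MemLp (fun ω => (randomState M α x₀ J G k ω).loc i) 2 P) := by
  induction k with
  | zero =>
    refine ⟨memLp_const _, fun i => memLp_const _, fun i => ?_⟩
    exact h.memLp_randomPoint_of_start (k := 0) hn hs i (memLp_const x₀) le_rfl
  | succ k ih =>
    refine ⟨?_, fun i => ?_, fun i => ?_⟩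
    · simp only [randomState, iterate_succ_xs hn]
      exact memLp_ite (h.measurableSet_event _ _)
        ((memLp_finsetSum Finset.univ fun i _ => ih.2.1 i).const_smul (1 / (n : ℝ))) ih.1
    · simp only [randomState, iterate_succ_y]
      exact memLp_ite (h.measurableSet_event _ _) (ih.2.2 i) (ih.2.1 i)
    · simp only [randomState, iterate_succ_loc]
      exact memLp_ite (h.measurableSet_event _ _)
        (h.memLp_randomPoint_of_start (k := k + 1) hn hs i ih.1 le_rfl) (ih.2.2 i)

theorem StochasticModel.memLp_randomPoint (h : StochasticModel P f σ p ps M α x₀ J G)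
    (hn : 0 < n) {L : ℝ} (hs : ∀ i, IsSmooth L (f i)) (k : ℕ) (i : Fin n) {m : ℕ} (hm : m ≤ M) :
    MemLp (randomPoint M α x₀ J G k i m) 2 P := by
  refine h.memLp_randomPoint_of_start hn hs i ?_ hm
  cases k with
  | zero => exact memLp_const x₀
  | succ k => exact (h.memLp_randomState hn hs k).1

/-! ### Local training -/

/-- A perturbation that is conditionally centred with conditional variance at most `σ ^ 2` adds at
most `t² σ²` to the conditional mean square of a variable known beforehand. -/
theorem setIntegral_norm_sub_smul_sq_le {m : MeasurableSpace Ω} (hm : m ≤ mΩ)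
    {a ξ : Ω → EuclideanSpace ℝ (Fin d)} (ha : Measurable[m] a) (haL : MemLp a 2 P)
    (hξL : MemLp ξ 2 P) (hξ : P[ξ | m] =ᵐ[P] 0)
    (hvar : P[fun ω => ‖ξ ω‖ ^ 2 | m] ≤ᵐ[P] fun _ => σ ^ 2) {A : Set Ω}
    (hA : MeasurableSet[m] A) (t : ℝ) :
    ∫ ω in A, ‖a ω - t • ξ ω‖ ^ 2 ∂P
      ≤ ∫ ω in A, ‖a ω‖ ^ 2 ∂P + t ^ 2 * σ ^ 2 * P.real A := by
  have ia : Integrable (fun ω => ‖a ω‖ ^ 2) P := haL.integrable_norm_pow two_ne_zero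
  have iξ : Integrable (fun ω => ‖ξ ω‖ ^ 2) P := hξL.integrable_norm_pow two_ne_zero
  have ii : Integrable (fun ω => inner ℝ (a ω) (ξ ω)) P := by
    refine Integrable.mono' (ia.add iξ) (haL.1.inner hξL.1)
      (Filter.Eventually.of_forall fun ω => ?_)
    have h1 := norm_inner_le_norm (𝕜 := ℝ) (a ω) (ξ ω)
    simp only [Pi.add_apply]
    nlinarith [sq_nonneg (‖a ω‖ - ‖ξ ω‖), sq_nonneg ‖a ω‖, sq_nonneg ‖ξ ω‖]
  have hcross : ∫ ω in A, inner ℝ (a ω) (ξ ω) ∂P = 0 := by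
    rw [← setIntegral_condExp hm ii hA]
    have h1 : P[fun ω => inner ℝ (a ω) (ξ ω) | m] =ᵐ[P] 0 := by
      refine (condExp_bilin_of_stronglyMeasurable_left (innerSL ℝ) ha.stronglyMeasurable ii
        (hξL.integrable one_le_two)).trans ?_
      filter_upwards [hξ] with ω hω
      simp [hω]
    rw [integral_congr_ae (ae_restrict_of_ae h1)]
    simp
  have hv : ∫ ω in A, ‖ξ ω‖ ^ 2 ∂P ≤ σ ^ 2 * P.real A := by
    rw [← setIntegral_condExp hm iξ hA]
    refine (integral_mono_ae integrable_condExp.integrableOn (integrable_const _)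
      (ae_restrict_of_ae hvar)).trans_eq ?_
    rw [setIntegral_const, smul_eq_mul, mul_comm]
  have hexp : ∀ ω, ‖a ω - t • ξ ω‖ ^ 2
      = ‖a ω‖ ^ 2 - 2 * t * inner ℝ (a ω) (ξ ω) + t ^ 2 * ‖ξ ω‖ ^ 2 := fun ω => by
    rw [norm_sub_sq_real, inner_smul_right, norm_smul, mul_pow, Real.norm_eq_abs, sq_abs]
    ring
  simp only [hexp]
  have i2 : Integrable (fun ω => 2 * t * inner ℝ (a ω) (ξ ω)) (P.restrict A) :=
    (ii.const_mul _).integrableOn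
  have i1 : Integrable (fun ω => ‖a ω‖ ^ 2 - 2 * t * inner ℝ (a ω) (ξ ω)) (P.restrict A) :=
    ia.integrableOn.sub i2
  rw [integral_add i1 (iξ.const_mul _).integrableOn, integral_sub ia.integrableOn i2,
    integral_const_mul, integral_const_mul, hcross]
  have := mul_le_mul_of_nonneg_left hv (sq_nonneg t)
  linarith

/-- Along local training, the mean square distance to noiseless gradient descent from `x` contracts
by the factor `c` of a gradient step, up to the accumulated noise. The event `A` on which the
distance is measured may depend on the server events so far. -/
theorem StochasticModel.setIntegral_randomPoint_sub_gdPath_le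
    (h : StochasticModel P f σ p ps M α x₀ J G) (hn : 0 < n) {L μ : ℝ}
    (hs : ∀ i, IsSmooth L (f i)) (hc : ∀ i, IsStronglyConvex μ (f i)) (k : ℕ) (hα : 0 ≤ α k)
    {c : ℝ} (hc0 : 0 ≤ c) (hc1 : c ≤ 1) (hcα : 1 - 2 * α k * μ + α k ^ 2 * L ^ 2 ≤ c) (i : Fin n)
    (x : EuclideanSpace ℝ (Fin d)) {A : Set Ω} (hA : MeasurableSet[eventHistory J k] A) {m : ℕ}
    (hm : m ≤ M) :
    ∫ ω in A, ‖randomPoint M α x₀ J G k i m ω - gdPath (f i) (α k) x m‖ ^ 2 ∂P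
      ≤ c ^ m * ∫ ω in A, ‖randomPoint M α x₀ J G k i 0 ω - x‖ ^ 2 ∂P
        + m * (α k ^ 2 * σ ^ 2) * P.real A := by
  induction m with
  | zero => simp [gdPath]
  | succ m ih =>
    have hp := h.memLp_randomPoint hn hs k i (Nat.le_of_succ_le hm)
    set z := gdPath (f i) (α k) x m with hz
    set F := randomPoint M α x₀ J G k i m with hF
    have hA' : MeasurableSet[pastCall M J G k i m] A :=
      (le_sup_left.trans le_sup_left : eventHistory J k ≤ pastCall M J G k i m) _ hA
    have hFm : Measurable[pastCall M J G k i m] F := measurable_randomPoint hn k i m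
    have hGm : Measurable[pastCall M J G k i m] fun ω => gradient (f i) (F ω) :=
      (hs i).continuous_gradient.measurable.comp hFm
    have hGp : MemLp (fun ω => F ω - α k • gradient (f i) (F ω)) 2 P :=
      hp.sub (((hs i).memLp_gradient hp).const_smul (α k))
    have h1 := setIntegral_norm_sub_smul_sq_le (P := P) (h.pastCall_le k i m)
      (a := fun ω => (F ω - α k • gradient (f i) (F ω)) - (z - α k • gradient (f i) z))
      ((hFm.sub (hGm.const_smul (α k))).sub_const _) (hGp.sub (memLp_const _))
      (h.memLp_noise hn hs k i hm) (h.unbiased k i m hm) (h.variance_le k i m hm) hA' (α k)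
    have h2 : ∫ ω in A, ‖randomPoint M α x₀ J G k i (m + 1) ω - gdPath (f i) (α k) x (m + 1)‖ ^ 2 ∂P
        = ∫ ω in A, ‖(F ω - α k • gradient (f i) (F ω)) - (z - α k • gradient (f i) z)
            - α k • noise f M α x₀ J G k i m ω‖ ^ 2 ∂P := by
      congr 1
      funext ω
      rw [randomPoint_succ f, gdPath]
      congr 2
      abel
    have h3 : ∫ ω in A, ‖(F ω - α k • gradient (f i) (F ω)) - (z - α k • gradient (f i) z)‖ ^ 2 ∂P
        ≤ c * ∫ ω in A, ‖F ω - z‖ ^ 2 ∂P := by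
      rw [← integral_const_mul]
      refine integral_mono_of_nonneg (Filter.Eventually.of_forall fun ω => sq_nonneg _)
        ((integrable_norm_sub_sq hp z).const_mul c).integrableOn
        (Filter.Eventually.of_forall fun ω => ?_)
      exact (norm_gradStep_sub_sq_le (hs i) (hc i) hα _ _).trans
        (mul_le_mul_of_nonneg_right hcα (sq_nonneg _))
    have ih' := ih (Nat.le_of_succ_le hm)
    have h4 := mul_le_mul_of_nonneg_left ih' hc0
    have h5 : 0 ≤ m * (α k ^ 2 * σ ^ 2) * P.real A := by positivity
    rw [h2]
    push_cast
    rw [pow_succ]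
    nlinarith

/-- Mean square error of the result of local training, compared with one step of length `M α k`
along the gradient at `x`. -/
theorem StochasticModel.setIntegral_randomPoint_sub_linear_le
    (h : StochasticModel P f σ p ps M α x₀ J G) (hn : 0 < n) {L μ : ℝ} (hL : 0 ≤ L)
    (hs : ∀ i, IsSmooth L (f i)) (hc : ∀ i, IsStronglyConvex μ (f i)) (k : ℕ) (hα : 0 ≤ α k)
    {c : ℝ} (hc0 : 0 ≤ c) (hc1 : c ≤ 1) (hcα : 1 - 2 * α k * μ + α k ^ 2 * L ^ 2 ≤ c)
    (hαL : α k * L ^ 2 ≤ 2 * μ) (i : Fin n) (x : EuclideanSpace ℝ (Fin d)) {A : Set Ω}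
    (hA : MeasurableSet[eventHistory J k] A) {ε b : ℝ} (hε : 0 < ε)
    (hb : α k ^ 2 * L * ‖gradient (f i) x‖ * (M * (M - 1) / 2) ≤ b) :
    ∫ ω in A, ‖randomPoint M α x₀ J G k i M ω - (x - (M * α k) • gradient (f i) x)‖ ^ 2 ∂P
      ≤ (1 + ε) * (c ^ M * ∫ ω in A, ‖randomPoint M α x₀ J G k i 0 ω - x‖ ^ 2 ∂P
        + M * (α k ^ 2 * σ ^ 2) * P.real A) + (1 + 1 / ε) * b ^ 2 * P.real A := by
  have hp := h.memLp_randomPoint hn hs k i le_rfl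
  set z := gdPath (f i) (α k) x M with hz
  set r := x - (M * α k) • gradient (f i) x with hr
  have h1 := h.setIntegral_randomPoint_sub_gdPath_le hn hs hc k hα hc0 hc1 hcα i x hA le_rfl
  have h2 : ‖z - r‖ ^ 2 ≤ b ^ 2 := by
    have := (norm_gdPath_sub_linear_le (hs i) (hc i) hα hL hαL x M).trans hb
    gcongr
  have i1 := ((integrable_norm_sub_sq hp z).const_mul (1 + ε)).integrableOn (s := A)
  have h3 : ∫ ω in A, ‖randomPoint M α x₀ J G k i M ω - r‖ ^ 2 ∂P
      ≤ ∫ ω in A, ((1 + ε) * ‖randomPoint M α x₀ J G k i M ω - z‖ ^ 2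
        + (1 + 1 / ε) * b ^ 2) ∂P := by
    refine integral_mono_of_nonneg (Filter.Eventually.of_forall fun ω => sq_nonneg _)
      (i1.add (integrable_const _)) (Filter.Eventually.of_forall fun ω => ?_)
    have h4 := norm_add_sq_le_young hε (randomPoint M α x₀ J G k i M ω - z) (z - r)
    rw [sub_add_sub_cancel] at h4
    exact h4.trans (add_le_add le_rfl (mul_le_mul_of_nonneg_left h2 (by positivity)))
  refine h3.trans ?_
  rw [integral_add i1 (integrable_const _), integral_const_mul, setIntegral_const, smul_eq_mul]
  have h5 := mul_le_mul_of_nonneg_left h1 (by positivity : 0 ≤ 1 + ε)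
  linarith

end Stochastic

/-! ### Recursions for the mean square errors -/

/-- If the points `r i` average to `x`, the average of the `v i` is at least as close to `x` as the
`v i` are to the `r i` in mean square. -/
theorem norm_average_sub_sq_le {E : Type*} [SeminormedAddCommGroup E] [NormedSpace ℝ E] {n : ℕ}
    (hn : 0 < n) (v r : Fin n → E) {x : E} (hr : (1 / (n : ℝ)) • ∑ i, r i = x) :
    ‖(1 / (n : ℝ)) • ∑ i, v i - x‖ ^ 2 ≤ 1 / (n : ℝ) * ∑ i, ‖v i - r i‖ ^ 2 := by
  rw [← hr, ← smul_sub, ← Finset.sum_sub_distrib]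
  exact norm_average_sq_le hn _

theorem average_const {E : Type*} [SeminormedAddCommGroup E] [NormedSpace ℝ E] {n : ℕ}
    (hn : 0 < n) (x : E) : (1 / (n : ℝ)) • ∑ _i : Fin n, x = x := by
  have hn' : (n : ℝ) ≠ 0 := by positivity
  rw [Finset.sum_const, Finset.card_univ, Fintype.card_fin, ← Nat.cast_smul_eq_nsmul ℝ, smul_smul,
    one_div_mul_cancel hn', one_smul]

section Recursion

variable {Ω : Type*} [mΩ : MeasurableSpace Ω] {P : Measure Ω} {n d M : ℕ}
  {f : Fin n → EuclideanSpace ℝ (Fin d) → ℝ} {σ ps L μ : ℝ} {p : Fin n → ℝ} {α : ℕ → ℝ}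
  {x₀ : EuclideanSpace ℝ (Fin d)} {J : ℕ → Ω → Option (Fin n)}
  {G : ℕ → Fin n → ℕ → Ω → EuclideanSpace ℝ (Fin d)}

/-- Mean square distance of a random vector to a point. -/
noncomputable abbrev meanSq (P : Measure Ω) (F : Ω → EuclideanSpace ℝ (Fin d))
    (r : EuclideanSpace ℝ (Fin d)) : ℝ :=
  ∫ ω, ‖F ω - r‖ ^ 2 ∂P

theorem meanSq_nonneg (F : Ω → EuclideanSpace ℝ (Fin d)) (r : EuclideanSpace ℝ (Fin d)) :
    0 ≤ meanSq P F r :=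
  integral_nonneg fun _ => sq_nonneg _

/-- The event of iteration `k + 1` is independent of a random vector determined by the past. -/
theorem StochasticModel.setIntegral_event (h : StochasticModel P f σ p ps M α x₀ J G) (k : ℕ)
    (e : Option (Fin n)) {A : Ω → EuclideanSpace ℝ (Fin d)} (hA : Measurable[past M J G k] A)
    (r : EuclideanSpace ℝ (Fin d)) :
    ∫ ω in {ω | J (k + 1) ω = e}, ‖A ω - r‖ ^ 2 ∂P
      = P.real {ω | J (k + 1) ω = e} * meanSq P A r := by
  have hA0 : Measurable A := hA.mono (h.past_le k) le_rfl
  refine Indep.setIntegral_eq_mul (m := MeasurableSpace.comap (J (k + 1)) ⊤) (X := A)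
    (f := fun v => ‖v - r‖ ^ 2) (h.measurable_event (k + 1)).comap_le ?_ hA0.aemeasurable ?_ ?_
  · exact indep_of_indep_of_le_right (h.indep_event k) hA.comap_le
  · exact ⟨{e}, trivial, rfl⟩
  · exact (by fun_prop : Continuous fun v : EuclideanSpace ℝ (Fin d) =>
      ‖v - r‖ ^ 2).aestronglyMeasurable

theorem StochasticModel.real_client (h : StochasticModel P f σ p ps M α x₀ J G)
    (hp : ∀ i, 0 < p i) (k : ℕ) (i : Fin n) : P.real {ω | J (k + 1) ω = some i} = p i := by
  have h1 : P {ω | J (k + 1) ω = some i} = ENNReal.ofReal (p i) := h.prob_client k i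
  rw [measureReal_def, h1, ENNReal.toReal_ofReal (hp i).le]

theorem StochasticModel.real_server (h : StochasticModel P f σ p ps M α x₀ J G)
    (hps : 0 < ps) (k : ℕ) : P.real {ω | J (k + 1) ω = none} = ps := by
  have h1 : P {ω | J (k + 1) ω = none} = ENNReal.ofReal ps := h.prob_server k
  rw [measureReal_def, h1, ENNReal.toReal_ofReal hps.le]

variable [IsProbabilityMeasure P]

theorem meanSq_le_young {F : Ω → EuclideanSpace ℝ (Fin d)} (hF : MemLp F 2 P)
    (r r' : EuclideanSpace ℝ (Fin d)) {ε : ℝ} (hε : 0 < ε) :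
    meanSq P F r' ≤ (1 + ε) * meanSq P F r + (1 + 1 / ε) * ‖r - r'‖ ^ 2 := by
  have i1 := (integrable_norm_sub_sq hF r).const_mul (1 + ε)
  have h3 : meanSq P F r' ≤ ∫ ω, ((1 + ε) * ‖F ω - r‖ ^ 2 + (1 + 1 / ε) * ‖r - r'‖ ^ 2) ∂P := by
    refine integral_mono (integrable_norm_sub_sq hF r') (i1.add (integrable_const _)) fun ω => ?_
    have h4 := norm_add_sq_le_young hε (F ω - r) (r - r')
    rwa [sub_add_sub_cancel] at h4
  refine h3.trans_eq ?_
  rw [integral_add i1 (integrable_const _), integral_const_mul]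
  simp

theorem StochasticModel.meanSq_ite (h : StochasticModel P f σ p ps M α x₀ J G) (k : ℕ)
    (e : Option (Fin n)) {A B : Ω → EuclideanSpace ℝ (Fin d)} (hA : MemLp A 2 P)
    (hB : MemLp B 2 P) (hBm : Measurable[past M J G k] B) (r : EuclideanSpace ℝ (Fin d)) :
    meanSq P (fun ω => if J (k + 1) ω = e then A ω else B ω) r
      = ∫ ω in {ω | J (k + 1) ω = e}, ‖A ω - r‖ ^ 2 ∂P
        + (1 - P.real {ω | J (k + 1) ω = e}) * meanSq P B r := by
  have hs := h.measurableSet_event (k + 1) e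
  have hi := integrable_norm_sub_sq (memLp_ite hs hA hB) r
  have hB1 := integral_add_compl hs (integrable_norm_sub_sq hB r)
  have hB2 := h.setIntegral_event k e hBm r
  have h1 : ∫ ω in {ω | J (k + 1) ω = e}, ‖(if J (k + 1) ω = e then A ω else B ω) - r‖ ^ 2 ∂P
      = ∫ ω in {ω | J (k + 1) ω = e}, ‖A ω - r‖ ^ 2 ∂P :=
    setIntegral_congr_fun hs fun ω hω => by
      have hω' : J (k + 1) ω = e := hω
      simp only [if_pos hω']
  have h2 : ∫ ω in {ω | J (k + 1) ω = e}ᶜ, ‖(if J (k + 1) ω = e then A ω else B ω) - r‖ ^ 2 ∂P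
      = ∫ ω in {ω | J (k + 1) ω = e}ᶜ, ‖B ω - r‖ ^ 2 ∂P :=
    setIntegral_congr_fun hs.compl fun ω hω => by
      have hω' : ¬ J (k + 1) ω = e := hω
      simp only [if_neg hω']
  rw [meanSq, ← integral_add_compl hs hi, h1, h2]
  simp only [meanSq] at hB2 ⊢
  linarith

theorem StochasticModel.integral_average_le (h : StochasticModel P f σ p ps M α x₀ J G)
    (hn : 0 < n) (hs : ∀ i, IsSmooth L (f i)) (k : ℕ) {r : Fin n → EuclideanSpace ℝ (Fin d)}
    {x : EuclideanSpace ℝ (Fin d)} (hr : (1 / (n : ℝ)) • ∑ i, r i = x) :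
    meanSq P (fun ω => (1 / (n : ℝ)) • ∑ i, (randomState M α x₀ J G k ω).y i) x
      ≤ 1 / (n : ℝ) * ∑ i, meanSq P (fun ω => (randomState M α x₀ J G k ω).y i) (r i) := by
  have hy := (h.memLp_randomState hn hs k).2.1
  rw [← integral_finsetSum _ fun i _ => integrable_norm_sub_sq (hy i) (r i), ← integral_const_mul]
  refine integral_mono ?_ ((integrable_finsetSum _ fun i _ =>
    integrable_norm_sub_sq (hy i) (r i)).const_mul _) fun ω => norm_average_sub_sq_le hn _ _ hr
  exact integrable_norm_sub_sq
    ((memLp_finsetSum Finset.univ fun i _ => hy i).const_smul (1 / (n : ℝ))) x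

/-- An aggregation replaces the server model by the average of the client memories. -/
theorem StochasticModel.meanSq_xs_succ_le (h : StochasticModel P f σ p ps M α x₀ J G)
    (hn : 0 < n) (hs : ∀ i, IsSmooth L (f i)) (hps : 0 < ps) (k : ℕ)
    {r : Fin n → EuclideanSpace ℝ (Fin d)} {x : EuclideanSpace ℝ (Fin d)}
    (hr : (1 / (n : ℝ)) • ∑ i, r i = x) :
    meanSq P (fun ω => (randomState M α x₀ J G (k + 1) ω).xs) x
      ≤ (1 - ps) * meanSq P (fun ω => (randomState M α x₀ J G k ω).xs) x
        + ps * (1 / (n : ℝ)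
          * ∑ i, meanSq P (fun ω => (randomState M α x₀ J G k ω).y i) (r i)) := by
  have hL := h.memLp_randomState hn hs k
  have hm := measurable_randomState (M := M) (α := α) (x₀ := x₀) (J := J) (G := G) hn k
  have hav := h.integral_average_le hn hs k hr
  set F : Ω → EuclideanSpace ℝ (Fin d) :=
    fun ω => (1 / (n : ℝ)) • ∑ i, (randomState M α x₀ J G k ω).y i with hF
  have hFp : MemLp F 2 P :=
    (memLp_finsetSum Finset.univ fun i _ => hL.2.1 i).const_smul (1 / (n : ℝ))
  have hsum : Measurable[past M J G k] fun ω => ∑ i, (randomState M α x₀ J G k ω).y i :=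
    Finset.measurable_fun_sum _ fun i _ => hm.2.1 i
  have hFm : Measurable[past M J G k] F := hsum.const_smul (1 / (n : ℝ))
  have hite := h.meanSq_ite k none hFp hL.1 hm.1 x
  rw [h.setIntegral_event k none hFm x, h.real_server hps] at hite
  have heq : (fun ω => (randomState M α x₀ J G (k + 1) ω).xs)
      = fun ω => if J (k + 1) ω = none then F ω else (randomState M α x₀ J G k ω).xs :=
    funext fun ω => iterate_succ_xs hn k
  rw [heq, hite]
  linarith [mul_le_mul_of_nonneg_left hav hps.le]

theorem StochasticModel.meanSq_y_succ (h : StochasticModel P f σ p ps M α x₀ J G)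
    (hn : 0 < n) (hs : ∀ i, IsSmooth L (f i)) (hp : ∀ i, 0 < p i) (k : ℕ) (i : Fin n)
    (r : EuclideanSpace ℝ (Fin d)) :
    meanSq P (fun ω => (randomState M α x₀ J G (k + 1) ω).y i) r
      = (1 - p i) * meanSq P (fun ω => (randomState M α x₀ J G k ω).y i) r
        + p i * meanSq P (fun ω => (randomState M α x₀ J G k ω).loc i) r := by
  have hL := h.memLp_randomState hn hs k
  have hm := measurable_randomState (M := M) (α := α) (x₀ := x₀) (J := J) (G := G) hn k
  simp only [randomState, iterate_succ_y]
  rw [h.meanSq_ite k (some i) (hL.2.2 i) (hL.2.1 i) (hm.2.1 i) r,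
    h.setIntegral_event k (some i) (hm.2.2 i) r, h.real_client hp, add_comm]

/-- The result of a new local training is measured against `x - (M α) ∇f_i(x)` for the current step
size `α`, and inherits a contracted error of the server model. -/
theorem StochasticModel.meanSq_loc_succ_le (h : StochasticModel P f σ p ps M α x₀ J G)
    (hn : 0 < n) (hL : 0 ≤ L) (hs : ∀ i, IsSmooth L (f i)) (hc : ∀ i, IsStronglyConvex μ (f i))
    (hp : ∀ i, 0 < p i) (k : ℕ) (hα : 0 ≤ α (k + 1)) {c : ℝ} (hc0 : 0 ≤ c) (hc1 : c ≤ 1)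
    (hcα : 1 - 2 * α (k + 1) * μ + α (k + 1) ^ 2 * L ^ 2 ≤ c) (hαL : α (k + 1) * L ^ 2 ≤ 2 * μ)
    (i : Fin n) (x : EuclideanSpace ℝ (Fin d)) {ε b : ℝ} (hε : 0 < ε)
    (hb : α (k + 1) ^ 2 * L * ‖gradient (f i) x‖ * (M * (M - 1) / 2) ≤ b) :
    meanSq P (fun ω => (randomState M α x₀ J G (k + 1) ω).loc i)
        (x - (M * α (k + 1)) • gradient (f i) x)
      ≤ (1 - p i) * meanSq P (fun ω => (randomState M α x₀ J G k ω).loc i)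
          (x - (M * α (k + 1)) • gradient (f i) x)
        + p i * ((1 + ε) * (c ^ M * meanSq P (fun ω => (randomState M α x₀ J G k ω).xs) x
            + M * (α (k + 1) ^ 2 * σ ^ 2)) + (1 + 1 / ε) * b ^ 2) := by
  have hLp := h.memLp_randomState hn hs k
  have hm := measurable_randomState (M := M) (α := α) (x₀ := x₀) (J := J) (G := G) hn k
  have hrp := h.memLp_randomPoint hn hs (k + 1) i le_rfl
  have h1 := h.setIntegral_randomPoint_sub_linear_le hn hL hs hc (k + 1) hα hc0 hc1 hcα hαL i x
    (measurableSet_event_of_history (Nat.le_add_left 1 k) le_rfl (some i)) hε hb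
  have h2 := h.setIntegral_event k (some i) hm.1 x
  have h3 : ∀ ω, randomPoint M α x₀ J G (k + 1) i 0 ω = (randomState M α x₀ J G k ω).xs :=
    fun _ => rfl
  simp only [h3, h2, h.real_client hp] at h1
  simp only [randomState, iterate_succ_loc] at h1 ⊢
  rw [h.meanSq_ite k (some i) hrp (hLp.2.2 i) (hm.2.2 i), h.real_client hp]
  linarith

/-! ### Crude bounds -/

theorem StochasticModel.integral_noise_le (h : StochasticModel P f σ p ps M α x₀ J G)
    (k : ℕ) (i : Fin n) {m : ℕ} (hm : m < M) :
    ∫ ω, ‖noise f M α x₀ J G k i m ω‖ ^ 2 ∂P ≤ σ ^ 2 := by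
  rw [← integral_condExp (h.pastCall_le k i m)]
  refine (integral_mono_ae integrable_condExp (integrable_const _)
    (h.variance_le k i m hm)).trans_eq ?_
  simp

/-- The factor by which local training can enlarge the mean square error. -/
noncomputable def growth (M : ℕ) (L a : ℝ) : ℝ :=
  (3 * (1 + a * L) ^ 2 + 3 * a ^ 2 * (L ^ 2 + 1) + 1) ^ M

theorem StochasticModel.meanSq_randomPoint_le (h : StochasticModel P f σ p ps M α x₀ J G)
    (hn : 0 < n) (hs : ∀ i, IsSmooth L (f i)) (k : ℕ) {a D : ℝ} (hα : 0 ≤ α k)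
    (ha : α k ≤ a) (i : Fin n) {x : EuclideanSpace ℝ (Fin d)}
    (hg : ‖gradient (f i) x‖ ^ 2 ≤ L ^ 2 * D) (hσ : σ ^ 2 ≤ D) :
    meanSq P (randomPoint M α x₀ J G k i M) x
      ≤ growth M L a * (meanSq P (randomPoint M α x₀ J G k i 0) x + D) := by
  have hD : 0 ≤ D := (sq_nonneg σ).trans hσ
  set c := 3 * (1 + a * L) ^ 2 + 3 * a ^ 2 * (L ^ 2 + 1) with hc
  have hc0 : 0 ≤ c := by positivity
  have key : ∀ m ≤ M, meanSq P (randomPoint M α x₀ J G k i m) x + D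
      ≤ (c + 1) ^ m * (meanSq P (randomPoint M α x₀ J G k i 0) x + D) := by
    intro m hm
    induction m with
    | zero => simp
    | succ m ih =>
      have hp := h.memLp_randomPoint hn hs k i (Nat.le_of_succ_le hm)
      have hint := integrable_norm_sub_sq hp x
      have hpt : ∀ ω, ‖randomPoint M α x₀ J G k i (m + 1) ω - x‖ ^ 2
          ≤ 3 * (1 + a * L) ^ 2 * ‖randomPoint M α x₀ J G k i m ω - x‖ ^ 2
            + 3 * a ^ 2 * ‖noise f M α x₀ J G k i m ω‖ ^ 2 + 3 * a ^ 2 * (L ^ 2 * D) := by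
        intro ω
        rw [randomPoint_succ f]
        set z := randomPoint M α x₀ J G k i m ω
        set ξ := noise f M α x₀ J G k i m ω
        have h1 : z - α k • gradient (f i) z - α k • ξ - x
            = (z - x) - α k • (gradient (f i) z - gradient (f i) x) - α k • gradient (f i) x
              - α k • ξ := by
          rw [smul_sub]
          abel
        have h2 : ‖z - α k • gradient (f i) z - α k • ξ - x‖
            ≤ (1 + a * L) * ‖z - x‖ + a * ‖gradient (f i) x‖ + a * ‖ξ‖ := by
          rw [h1]
          refine (norm_sub_le _ _).trans (add_le_add ((norm_sub_le _ _).trans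
            (add_le_add ((norm_sub_le _ _).trans ?_) ?_)) ?_)
          · rw [norm_smul, Real.norm_of_nonneg hα]
            have := mul_le_mul ha ((hs i).2 z x) (norm_nonneg _) (hα.trans ha)
            linarith
          · rw [norm_smul, Real.norm_of_nonneg hα]
            gcongr
          · rw [norm_smul, Real.norm_of_nonneg hα]
            gcongr
        have h3 := pow_le_pow_left₀ (norm_nonneg _) h2 2
        have h4 := mul_le_mul_of_nonneg_left hg (by positivity : 0 ≤ 3 * a ^ 2)
        nlinarith [sq_nonneg ((1 + a * L) * ‖z - x‖ - a * ‖gradient (f i) x‖),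
          sq_nonneg ((1 + a * L) * ‖z - x‖ - a * ‖ξ‖),
          sq_nonneg (a * ‖gradient (f i) x‖ - a * ‖ξ‖)]
      have i1 := hint.const_mul (3 * (1 + a * L) ^ 2)
      have i2 := (h.integrable_noise k i m hm).const_mul (3 * a ^ 2)
      have i3 : Integrable (fun ω => 3 * (1 + a * L) ^ 2 * ‖randomPoint M α x₀ J G k i m ω - x‖ ^ 2
          + 3 * a ^ 2 * ‖noise f M α x₀ J G k i m ω‖ ^ 2) P := i1.add i2
      have h5 : meanSq P (randomPoint M α x₀ J G k i (m + 1)) x ≤ _ :=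
        integral_mono (integrable_norm_sub_sq (h.memLp_randomPoint hn hs k i hm) x)
          (i3.add (integrable_const (3 * a ^ 2 * (L ^ 2 * D)))) hpt
      simp only [Pi.add_apply] at h5
      have h6 : ∫ ω, (3 * (1 + a * L) ^ 2 * ‖randomPoint M α x₀ J G k i m ω - x‖ ^ 2
            + 3 * a ^ 2 * ‖noise f M α x₀ J G k i m ω‖ ^ 2 + 3 * a ^ 2 * (L ^ 2 * D)) ∂P
          = 3 * (1 + a * L) ^ 2 * meanSq P (randomPoint M α x₀ J G k i m) x
            + 3 * a ^ 2 * ∫ ω, ‖noise f M α x₀ J G k i m ω‖ ^ 2 ∂P + 3 * a ^ 2 * (L ^ 2 * D) := by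
        rw [integral_add i3 (integrable_const _), integral_add i1 i2,
          integral_const_mul, integral_const_mul]
        simp
      have h7 := mul_le_mul_of_nonneg_left ((h.integral_noise_le k i hm).trans hσ)
        (by positivity : 0 ≤ 3 * a ^ 2)
      have h8 := mul_le_mul_of_nonneg_left (ih (Nat.le_of_succ_le hm)) (by positivity : 0 ≤ c + 1)
      have h9 := meanSq_nonneg (P := P) (randomPoint M α x₀ J G k i m) x
      have h10 : 0 ≤ (1 + a * L) ^ 2 * D := by positivity
      have h11 : 0 ≤ 3 * a ^ 2 * (L ^ 2 + 1) * meanSq P (randomPoint M α x₀ J G k i m) x := by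
        positivity
      rw [pow_succ]
      simp only [meanSq] at *
      rw [h6] at h5
      nlinarith
  have := key M le_rfl
  rw [growth]
  linarith

/-- A bound on the mean square errors after `k` iterations, relative to `max σ ζ ^ 2`. -/
noncomputable def crudeBound (M : ℕ) (L a ρ : ℝ) : ℕ → ℝ
  | 0 => growth M L a * (ρ ^ 2 + 1)
  | k + 1 => 2 * crudeBound M L a ρ k + growth M L a * (crudeBound M L a ρ k + 1)

theorem one_le_growth (M : ℕ) {L a : ℝ} : 1 ≤ growth M L a := by
  refine one_le_pow₀ ?_
  nlinarith [sq_nonneg (1 + a * L), mul_nonneg (sq_nonneg a) (sq_nonneg L), sq_nonneg a]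

theorem crudeBound_nonneg (M : ℕ) {L a ρ : ℝ} (k : ℕ) : 0 ≤ crudeBound M L a ρ k := by
  have hg := one_le_growth M (L := L) (a := a)
  induction k with
  | zero =>
    rw [crudeBound]
    positivity
  | succ k ih =>
    rw [crudeBound]
    positivity

theorem meanSq_ite_le {s : Ω → Prop} [DecidablePred s] (hs : MeasurableSet {ω | s ω})
    {A B : Ω → EuclideanSpace ℝ (Fin d)} (hA : MemLp A 2 P) (hB : MemLp B 2 P)
    (r : EuclideanSpace ℝ (Fin d)) :
    meanSq P (fun ω => if s ω then A ω else B ω) r ≤ meanSq P A r + meanSq P B r := by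
  rw [← integral_add (integrable_norm_sub_sq hA r) (integrable_norm_sub_sq hB r)]
  refine integral_mono (integrable_norm_sub_sq (memLp_ite hs hA hB) r)
    ((integrable_norm_sub_sq hA r).add (integrable_norm_sub_sq hB r)) fun ω => ?_
  by_cases hω : s ω
  · simp [hω]
  · simp [hω]

theorem StochasticModel.meanSq_le_crudeBound (h : StochasticModel P f σ p ps M α x₀ J G)
    (hn : 0 < n) (hs : ∀ i, IsSmooth L (f i)) {a D ρ : ℝ} (hα : ∀ k, 0 ≤ α k)
    (ha : ∀ k, α k ≤ a) {x : EuclideanSpace ℝ (Fin d)}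
    (hg : ∀ i, ‖gradient (f i) x‖ ^ 2 ≤ L ^ 2 * D) (hσ : σ ^ 2 ≤ D)
    (hx : ‖x₀ - x‖ ^ 2 ≤ ρ ^ 2 * D) (k : ℕ) :
    meanSq P (fun ω => (randomState M α x₀ J G k ω).xs) x ≤ crudeBound M L a ρ k * D ∧
    (∀ i, meanSq P (fun ω => (randomState M α x₀ J G k ω).y i) x ≤ crudeBound M L a ρ k * D) ∧
    (∀ i, meanSq P (fun ω => (randomState M α x₀ J G k ω).loc i) x
      ≤ crudeBound M L a ρ k * D) := by
  have hD : 0 ≤ D := (sq_nonneg σ).trans hσ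
  have hgr := one_le_growth M (L := L) (a := a)
  induction k with
  | zero =>
    have h0 : ‖x₀ - x‖ ^ 2 ≤ crudeBound M L a ρ 0 * D := by
      rw [crudeBound]
      have : 0 ≤ (ρ ^ 2 + 1) * D := by positivity
      nlinarith [mul_le_mul_of_nonneg_right hgr this]
    refine ⟨?_, fun i => ?_, fun i => ?_⟩
    · simpa [meanSq, iterate] using h0
    · simpa [meanSq, iterate] using h0
    · refine (h.meanSq_randomPoint_le hn hs 0 (hα 0) (ha 0) i (hg i) hσ).trans ?_
      have h1 : meanSq P (randomPoint M α x₀ J G 0 i 0) x = ‖x₀ - x‖ ^ 2 := by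
        simp [meanSq, localPoint, handedOut, localSGD]
      rw [h1, crudeBound, mul_assoc, add_mul, one_mul]
      gcongr
  | succ k ih =>
    have hB := crudeBound_nonneg M (L := L) (a := a) (ρ := ρ) k
    have hLp := h.memLp_randomState hn hs k
    have hBD : 0 ≤ growth M L a * ((crudeBound M L a ρ k + 1) * D) := by positivity
    refine ⟨?_, fun i => ?_, fun i => ?_⟩
    · simp only [randomState, iterate_succ_xs hn]
      refine (meanSq_ite_le (h.measurableSet_event _ _) ((memLp_finsetSum Finset.univ
        fun i _ => hLp.2.1 i).const_smul (1 / (n : ℝ))) hLp.1 x).trans ?_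
      have h1 := h.integral_average_le hn hs k (average_const hn x)
      have h2 : 1 / (n : ℝ) * ∑ i, meanSq P (fun ω => (randomState M α x₀ J G k ω).y i) x
          ≤ crudeBound M L a ρ k * D := by
        have h3 := Finset.sum_le_sum fun i (_ : i ∈ Finset.univ) => ih.2.1 i
        rw [Finset.sum_const, Finset.card_univ, Fintype.card_fin, nsmul_eq_mul] at h3
        have hn' : (0 : ℝ) < n := by exact_mod_cast hn
        rw [one_div_mul_eq_div, div_le_iff₀ hn']
        linarith
      have h4 := ih.1
      have h5 := h1.trans h2
      rw [crudeBound]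
      simp only [meanSq, Pi.smul_apply] at h4 h5 ⊢
      linarith
    · simp only [randomState, iterate_succ_y]
      refine (meanSq_ite_le (h.measurableSet_event _ _) (hLp.2.2 i) (hLp.2.1 i) x).trans ?_
      have h4 := ih.2.1 i
      have h5 := ih.2.2 i
      rw [crudeBound]
      simp only [meanSq] at h4 h5 ⊢
      linarith
    · simp only [randomState, iterate_succ_loc]
      refine (meanSq_ite_le (h.measurableSet_event _ _)
        (h.memLp_randomPoint hn hs (k + 1) i le_rfl) (hLp.2.2 i) x).trans ?_
      have h4 := ih.2.2 i
      have h5 := h.meanSq_randomPoint_le hn hs (k + 1) (hα _) (ha _) i (hg i) hσ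
      have h6 : growth M L a * (meanSq P (randomPoint M α x₀ J G (k + 1) i 0) x + D)
          ≤ growth M L a * (crudeBound M L a ρ k * D + D) := by
        refine mul_le_mul_of_nonneg_left ?_ (zero_le_one.trans hgr)
        have := ih.1
        exact add_le_add this le_rfl
      have h7 : 0 ≤ crudeBound M L a ρ k * D := by positivity
      rw [crudeBound]
      simp only [meanSq] at h4 h5 h6 ⊢
      linarith

end Recursion

/-! ### The Lyapunov function -/

section Lyapunov

variable {n : ℕ}

/-- The Lyapunov function: `X`, `Y i`, `Z i` are the mean square errors of the server model, the
memory and the local result of client `i`. Each error enters with the inverse of the rate at which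
it is refreshed, and one more factor `1 / (1 - s)` for each stage of the delay. -/
noncomputable def lyapunov (p : Fin n → ℝ) (ps s X : ℝ) (Y Z : Fin n → ℝ) : ℝ :=
  X / ps + 1 / (1 - s) * (1 / (n : ℝ) * ∑ i, Y i / p i)
    + (1 / (1 - s)) ^ 2 * (1 / (n : ℝ) * ∑ i, Z i / p i)

variable {p : Fin n → ℝ} {ps : ℝ}

theorem qBar_nonneg (hp : ∀ i, 0 < p i) : 0 ≤ qBar p :=
  mul_nonneg (by positivity) (Finset.sum_nonneg fun i _ => (one_div_pos.2 (hp i)).le)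

theorem lyapunov_nonneg (hp : ∀ i, 0 < p i) (hps : 0 < ps) {s X : ℝ} {Y Z : Fin n → ℝ}
    (hs : s < 1) (hX : 0 ≤ X) (hY : ∀ i, 0 ≤ Y i) (hZ : ∀ i, 0 ≤ Z i) :
    0 ≤ lyapunov p ps s X Y Z := by
  have h1 : 0 ≤ ∑ i, Y i / p i := Finset.sum_nonneg fun i _ => div_nonneg (hY i) (hp i).le
  have h2 : 0 ≤ ∑ i, Z i / p i := Finset.sum_nonneg fun i _ => div_nonneg (hZ i) (hp i).le
  have h3 : 0 < 1 - s := by linarith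
  rw [lyapunov]
  positivity

/-- One iteration multiplies the Lyapunov function by `1 - pm s`, up to the noise, when local
training contracts by `1 - 3 s` and every event has probability at least `pm`. -/
theorem lyapunov_succ_le (hn : 0 < n) (hp : ∀ i, 0 < p i) (hps : 0 < ps) {pm s N X X' : ℝ}
    {Y Y' Z Z' : Fin n → ℝ} (hpm : ∀ i, pm ≤ p i) (hpms : pm ≤ ps) (hs0 : 0 ≤ s)
    (hs1 : s < 1) (hX0 : 0 ≤ X) (hY0 : ∀ i, 0 ≤ Y i) (hZ0 : ∀ i, 0 ≤ Z i)
    (hX : X' ≤ (1 - ps) * X + ps * (1 / (n : ℝ) * ∑ i, Y i))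
    (hY : ∀ i, Y' i ≤ (1 - p i) * Y i + p i * Z i)
    (hZ : ∀ i, Z' i ≤ (1 - p i) * Z i + p i * ((1 - 3 * s) * X + N)) :
    lyapunov p ps s X' Y' Z' ≤ (1 - pm * s) * lyapunov p ps s X Y Z + (1 / (1 - s)) ^ 2 * N := by
  have hn' : (0 : ℝ) < n := by exact_mod_cast hn
  set u := 1 / (1 - s) with hu
  have hu0 : 0 < u := one_div_pos.2 (by linarith)
  have hus : u * (1 - s) = 1 := one_div_mul_cancel (by linarith)
  have havg : ∀ {A B : Fin n → ℝ}, (∀ i, A i ≤ B i) →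
      1 / (n : ℝ) * ∑ i, A i ≤ 1 / (n : ℝ) * ∑ i, B i := fun hAB =>
    mul_le_mul_of_nonneg_left (Finset.sum_le_sum fun i _ => hAB i) (by positivity)
  have hconst : ∀ c : ℝ, 1 / (n : ℝ) * ∑ _i : Fin n, c = c := fun c => by
    rw [Finset.sum_const, Finset.card_univ, Fintype.card_fin, nsmul_eq_mul]
    field_simp
  have hlow : ∀ {A : Fin n → ℝ}, (∀ i, 0 ≤ A i) →
      pm * (1 / (n : ℝ) * ∑ i, A i / p i) ≤ 1 / (n : ℝ) * ∑ i, A i := fun {A} hA => by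
    rw [mul_left_comm, Finset.mul_sum]
    refine havg fun i => ?_
    rw [mul_div_left_comm]
    exact mul_le_of_le_one_right (hA i) ((div_le_one (hp i)).2 (hpm i))
  set SY := 1 / (n : ℝ) * ∑ i, Y i / p i with hSY
  set SZ := 1 / (n : ℝ) * ∑ i, Z i / p i with hSZ
  set MY := 1 / (n : ℝ) * ∑ i, Y i with hMY
  set MZ := 1 / (n : ℝ) * ∑ i, Z i with hMZ
  have h1 : X' / ps ≤ X / ps - X + MY := by
    rw [div_le_iff₀ hps]
    refine hX.trans_eq ?_
    field_simp
  have h2 : 1 / (n : ℝ) * ∑ i, Y' i / p i ≤ SY - MY + MZ := by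
    have : SY - MY + MZ = 1 / (n : ℝ) * ∑ i, (Y i / p i - Y i + Z i) := by
      rw [Finset.sum_add_distrib, Finset.sum_sub_distrib]
      ring
    rw [this]
    refine havg fun i => ?_
    rw [div_le_iff₀ (hp i)]
    refine (hY i).trans_eq ?_
    have := (hp i).ne'
    field_simp
  have h3 : 1 / (n : ℝ) * ∑ i, Z' i / p i ≤ SZ - MZ + ((1 - 3 * s) * X + N) := by
    have : SZ - MZ + ((1 - 3 * s) * X + N)
        = 1 / (n : ℝ) * ∑ i, (Z i / p i - Z i + ((1 - 3 * s) * X + N)) := by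
      rw [Finset.sum_add_distrib, Finset.sum_sub_distrib, mul_add, mul_sub, hconst]
    rw [this]
    refine havg fun i => ?_
    rw [div_le_iff₀ (hp i)]
    refine (hZ i).trans_eq ?_
    have := (hp i).ne'
    field_simp
  -- the contraction `1 - 3 s` pays for the two weight factors `u` and for the decrease `1 - s`
  have h4 : u ^ 2 * (1 - 3 * s) ≤ 1 - s := by
    have h5 : 1 - 3 * s ≤ (1 - s) ^ 3 := by nlinarith [mul_nonneg hs0 hs0]
    calc u ^ 2 * (1 - 3 * s) ≤ u ^ 2 * (1 - s) ^ 3 := by gcongr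
      _ = (u * (1 - s)) ^ 2 * (1 - s) := by ring
      _ = 1 - s := by rw [hus]; ring
  have h6 : pm * s * (X / ps) ≤ s * X := by
    have : pm * (X / ps) ≤ X := by
      rw [mul_div_left_comm]
      exact mul_le_of_le_one_right hX0 ((div_le_one hps).2 hpms)
    nlinarith
  have h7 := mul_le_mul_of_nonneg_left (hlow hY0) (by positivity : 0 ≤ u * s)
  have h8 := mul_le_mul_of_nonneg_left (hlow hZ0) (by positivity : 0 ≤ u ^ 2 * s)
  have h9 := mul_le_mul_of_nonneg_left h2 hu0.le
  have h10 := mul_le_mul_of_nonneg_left h3 (by positivity : 0 ≤ u ^ 2)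
  have h11 := mul_le_mul_of_nonneg_right h4 hX0
  have hu1 : u = 1 + u * s := by linarith
  have hu2 : u ^ 2 = u + u ^ 2 * s := by
    calc u ^ 2 = u * u := sq u
      _ = u * (1 + u * s) := by rw [← hu1]
      _ = u + u ^ 2 * s := by ring
  have h12 : u * MY = MY + u * s * MY := by
    conv_lhs => rw [hu1]
    ring
  have h13 : u ^ 2 * MZ = u * MZ + u ^ 2 * s * MZ := by
    conv_lhs => rw [hu2]
    ring
  simp only [lyapunov, ← hu, ← hSY, ← hSZ]
  nlinarith

theorem lyapunov_mono_weight (hn : 0 < n) (hp : ∀ i, 0 < p i) {s t X : ℝ} {Y Z : Fin n → ℝ}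
    (hst : s ≤ t) (ht : t < 1) (hY0 : ∀ i, 0 ≤ Y i) (hZ0 : ∀ i, 0 ≤ Z i) :
    lyapunov p ps s X Y Z ≤ lyapunov p ps t X Y Z := by
  have hY : 0 ≤ ∑ i, Y i / p i := Finset.sum_nonneg fun i _ => div_nonneg (hY0 i) (hp i).le
  have hZ : 0 ≤ ∑ i, Z i / p i := Finset.sum_nonneg fun i _ => div_nonneg (hZ0 i) (hp i).le
  have h1 : 0 < 1 - t := by linarith
  have h2 : 0 < 1 - s := by linarith
  simp only [lyapunov]
  gcongr

/-- Effect on the Lyapunov function of a bounded change of the points of comparison. -/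
theorem lyapunov_le_of_shift (hp : ∀ i, 0 < p i) (hps : 0 < ps) {s ε S X : ℝ}
    {Y Y' Z Z' : Fin n → ℝ} (hs : s ≤ 1 / 9) (hε : 0 ≤ ε) (hS : 0 ≤ S) (hX : 0 ≤ X)
    (hY : ∀ i, Y' i ≤ (1 + ε) * Y i + S) (hZ : ∀ i, Z' i ≤ (1 + ε) * Z i + S) :
    lyapunov p ps s X Y' Z' ≤ (1 + ε) * lyapunov p ps s X Y Z + 3 * qBar p * S := by
  set u := 1 / (1 - s) with hu
  have hu0 : 0 < u := one_div_pos.2 (by linarith)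
  have hu1 : u ≤ 9 / 8 := by
    rw [hu, div_le_iff₀ (by linarith)]
    linarith
  have hq := qBar_nonneg hp
  have key : ∀ {A A' : Fin n → ℝ}, (∀ i, A' i ≤ (1 + ε) * A i + S) →
      1 / (n : ℝ) * ∑ i, A' i / p i
        ≤ (1 + ε) * (1 / (n : ℝ) * ∑ i, A i / p i) + qBar p * S := fun {A A'} hA => by
    have h1 : (1 + ε) * (1 / (n : ℝ) * ∑ i, A i / p i) + qBar p * S
        = 1 / (n : ℝ) * ∑ i, ((1 + ε) * (A i / p i) + 1 / p i * S) := by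
      rw [Finset.sum_add_distrib, ← Finset.mul_sum, ← Finset.sum_mul, qBar]
      ring
    rw [h1]
    refine mul_le_mul_of_nonneg_left (Finset.sum_le_sum fun i _ => ?_) (by positivity)
    calc A' i / p i ≤ ((1 + ε) * A i + S) / p i := by
          have := (hp i).le
          have := hA i
          gcongr
      _ = (1 + ε) * (A i / p i) + 1 / p i * S := by ring
  have h1 := mul_le_mul_of_nonneg_left (key hY) hu0.le
  have h2 := mul_le_mul_of_nonneg_left (key hZ) (by positivity : 0 ≤ u ^ 2)
  have h3 : u + u ^ 2 ≤ 3 := by nlinarith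
  have h4 := mul_le_mul_of_nonneg_right h3 (mul_nonneg hq hS)
  have h5 : 0 ≤ ε * (X / ps) := by positivity
  simp only [lyapunov, ← hu]
  nlinarith

/-- `M` local contractions by `1 - 3 t / 2`, together with the loss `1 + M t / 4` in Young's
inequality, contract by `1 - 3 M t / 4`. -/
theorem one_add_mul_pow_le {M : ℕ} {t : ℝ} (ht : 0 ≤ t) (hM : M * t ≤ 4 / 9) (hM0 : 0 < M) :
    (1 + M * t / 4) * (1 - 3 / 2 * t) ^ M ≤ 1 - 3 * (M * t / 4) := by
  have hM1 : (1 : ℝ) ≤ M := by exact_mod_cast hM0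
  have ht1 : t ≤ 4 / 9 := by nlinarith
  have h1 := one_sub_pow_le (t := 3 / 2 * t) (by linarith) (by linarith) M
  set θ := (M : ℝ) * t with hθ
  have hθ0 : 0 ≤ θ := by positivity
  have h2 : (1 - 3 / 2 * t) ^ M ≤ 1 - θ := by
    refine h1.trans ?_
    have : (M : ℝ) * (3 / 2 * t) = 3 / 2 * θ := by
      rw [hθ]
      ring
    rw [this]
    nlinarith
  have h3 := mul_le_mul_of_nonneg_left h2 (by positivity : 0 ≤ 1 + θ / 4)
  nlinarith

/-- The arithmetic that combines a contraction by `1 - r` with a loss `1 + r / 4` and with weights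
parametrized by `s`. -/
theorem contraction_combine {r s q S N b E V W : ℝ} (hr0 : 0 < r) (hr1 : r ≤ 1) (hs0 : 0 < s)
    (hs9 : s ≤ 1 / 9) (hq : 0 ≤ q) (hS : 0 ≤ S) (hN : 0 ≤ N) (hE : 0 ≤ E)
    (hW : W ≤ (1 + r / 4) * E + 3 * q * ((1 + 1 / (r / 4)) * S))
    (hV : V ≤ (1 - r) * W + (1 / (1 - s)) ^ 2 * ((1 + s) * N + (1 + 1 / s) * b ^ 2)) :
    V ≤ (1 - 3 / 4 * r) * E + 12 * q * S / r + 3 / 2 * N + 3 / 2 * b ^ 2 / s := by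
  have h4 := mul_le_mul_of_nonneg_left hW (by linarith : 0 ≤ 1 - r)
  have h5 : (1 - r) * (1 + r / 4) ≤ 1 - 3 / 4 * r := by nlinarith [sq_nonneg r]
  have h6 := mul_le_mul_of_nonneg_right h5 hE
  have h7 : (1 - r) * (1 + 1 / (r / 4)) ≤ 4 / r := by
    have e1 : (1 - r) * (1 + 1 / (r / 4)) = 4 / r - 3 - r := by
      field_simp
      ring
    linarith
  have h8 := mul_le_mul_of_nonneg_right h7 (mul_nonneg (by positivity : 0 ≤ 3 * q) hS)
  have h9 : (1 / (1 - s)) ^ 2 ≤ 27 / 20 := by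
    have e1 : 1 / (1 - s) ≤ 9 / 8 := by
      rw [div_le_iff₀ (by linarith)]
      linarith
    have e2 : 0 ≤ 1 / (1 - s) := one_div_nonneg.2 (by linarith)
    nlinarith
  have h10 : (1 + s) * N ≤ 10 / 9 * N := mul_le_mul_of_nonneg_right (by linarith) hN
  have h11 : (1 + 1 / s) * b ^ 2 ≤ 10 / 9 * (b ^ 2 / s) := by
    have e1 : 9 ≤ 1 / s := by
      rw [le_div_iff₀ hs0]
      linarith
    have e2 : b ^ 2 / s = 1 / s * b ^ 2 := by ring
    rw [e2]
    nlinarith [sq_nonneg b]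
  have h12 : (1 / (1 - s)) ^ 2 * ((1 + s) * N + (1 + 1 / s) * b ^ 2)
      ≤ 27 / 20 * (10 / 9 * N + 10 / 9 * (b ^ 2 / s)) := by
    have : 0 ≤ (1 + s) * N + (1 + 1 / s) * b ^ 2 := by positivity
    exact mul_le_mul h9 (add_le_add h10 h11) this (by norm_num)
  have h13 : 4 / r * (3 * q * S) = 12 * q * S / r := by ring
  have h14 : 3 / 2 * b ^ 2 / s = 3 / 2 * (b ^ 2 / s) := by ring
  have h15 : (1 - r) * ((1 + r / 4) * E + 3 * q * ((1 + 1 / (r / 4)) * S))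
      = (1 - r) * (1 + r / 4) * E + (1 - r) * (1 + 1 / (r / 4)) * (3 * q * S) := by ring
  rw [h13] at h8
  rw [h14]
  linarith

/-- A contraction by `1 - 4 / k` turns sources of order `k⁻²` and `k⁻³` into errors of order `k⁻¹`
and `k⁻²`, and forgets the initial value at the rate `k⁻³`. -/
theorem le_of_contraction {V : ℕ → ℝ} {A B E : ℝ} {k₁ : ℕ} (hA : 0 ≤ A) (hB : 0 ≤ B)
    (hE : 0 ≤ E) (hk : 4 ≤ k₁) (h0 : V k₁ ≤ E)
    (hV : ∀ k, k₁ ≤ k → V (k + 1) ≤ (1 - 4 / ((k + 1 : ℕ) : ℝ)) * V k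
      + A / ((k + 1 : ℕ) : ℝ) ^ 2 + B / ((k + 1 : ℕ) : ℝ) ^ 3) (k : ℕ) (hkk : k₁ ≤ k) :
    V k ≤ A / (3 * k) + B / (2 * k ^ 2) + E * (k₁ : ℝ) ^ 3 / k ^ 3 := by
  induction k, hkk using Nat.le_induction with
  | base =>
    have h1 : (0 : ℝ) < k₁ := by exact_mod_cast (by omega : 0 < k₁)
    have h2 : E * (k₁ : ℝ) ^ 3 / k₁ ^ 3 = E := by field_simp
    have h3 : 0 ≤ A / (3 * (k₁ : ℝ)) := by positivity
    have h4 : 0 ≤ B / (2 * (k₁ : ℝ) ^ 2) := by positivity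
    linarith
  | succ k hk1 ih =>
    have hx4 : (4 : ℝ) ≤ k := by exact_mod_cast hk.trans hk1
    have h := hV k hk1
    push_cast at h ⊢
    set x : ℝ := (k : ℝ)
    have hx : 0 < x := by linarith
    have hy : 0 < x + 1 := by linarith
    have hc : 0 ≤ 1 - 4 / (x + 1) := by
      rw [sub_nonneg, div_le_one hy]
      linarith
    have h1 := mul_le_mul_of_nonneg_left ih hc
    have e1 : (1 - 4 / (x + 1)) * (1 / (3 * x)) + 1 / (x + 1) ^ 2 ≤ 1 / (3 * (x + 1)) := by
      rw [← sub_nonneg]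
      have : 1 / (3 * (x + 1)) - ((1 - 4 / (x + 1)) * (1 / (3 * x)) + 1 / (x + 1) ^ 2)
          = 1 / (x * (x + 1) ^ 2) := by
        field_simp
        ring
      rw [this]
      positivity
    have e2 : (1 - 4 / (x + 1)) * (1 / (2 * x ^ 2)) + 1 / (x + 1) ^ 3 ≤ 1 / (2 * (x + 1) ^ 2) := by
      rw [← sub_nonneg]
      have : 1 / (2 * (x + 1) ^ 2) - ((1 - 4 / (x + 1)) * (1 / (2 * x ^ 2)) + 1 / (x + 1) ^ 3)
          = (5 * x + 3) / (2 * x ^ 2 * (x + 1) ^ 3) := by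
        field_simp
        ring
      rw [this]
      positivity
    have e3 : (1 - 4 / (x + 1)) * (1 / x ^ 3) ≤ 1 / (x + 1) ^ 3 := by
      rw [← sub_nonneg]
      have : 1 / (x + 1) ^ 3 - (1 - 4 / (x + 1)) * (1 / x ^ 3)
          = (x ^ 2 + 5 * x + 3) / (x ^ 3 * (x + 1) ^ 3) := by
        field_simp
        ring
      rw [this]
      positivity
    have f1 := mul_le_mul_of_nonneg_left e1 hA
    have f2 := mul_le_mul_of_nonneg_left e2 hB
    have f3 := mul_le_mul_of_nonneg_left e3 (by positivity : 0 ≤ E * (k₁ : ℝ) ^ 3)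
    have g1 : (1 - 4 / (x + 1)) * (A / (3 * x) + B / (2 * x ^ 2) + E * (k₁ : ℝ) ^ 3 / x ^ 3)
          + A / (x + 1) ^ 2 + B / (x + 1) ^ 3
        = A * ((1 - 4 / (x + 1)) * (1 / (3 * x)) + 1 / (x + 1) ^ 2)
          + B * ((1 - 4 / (x + 1)) * (1 / (2 * x ^ 2)) + 1 / (x + 1) ^ 3)
          + E * (k₁ : ℝ) ^ 3 * ((1 - 4 / (x + 1)) * (1 / x ^ 3)) := by
      ring
    have g2 : A / (3 * (x + 1)) + B / (2 * (x + 1) ^ 2) + E * (k₁ : ℝ) ^ 3 / (x + 1) ^ 3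
        = A * (1 / (3 * (x + 1))) + B * (1 / (2 * (x + 1) ^ 2))
          + E * (k₁ : ℝ) ^ 3 * (1 / (x + 1) ^ 3) := by
      ring
    rw [g2]
    linarith

end Lyapunov

/-! ### The step sizes -/

section StepSize

variable {n M : ℕ} {p : Fin n → ℝ} {ps μ L : ℝ}

theorem pMin_le (i : Fin n) : pMin p ps ≤ p i :=
  (min_le_left _ _).trans (ciInf_le (Set.finite_range p).bddBelow i)

theorem pMin_le_server : pMin p ps ≤ ps :=
  min_le_right _ _

theorem pMin_pos (hn : 0 < n) (hp : ∀ i, 0 < p i) (hps : 0 < ps) : 0 < pMin p ps := by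
  have : Nonempty (Fin n) := ⟨⟨0, hn⟩⟩
  obtain ⟨i, hi⟩ := exists_eq_ciInf_of_finite (f := p)
  exact lt_min (hi ▸ hp i) hps

theorem gam_pos (hμ : 0 < μ) (hL : 0 < L) : 0 < gam μ L := by
  rw [gam]
  positivity

theorem gam_le (hμ : 0 < μ) (hL : 0 < L) : gam μ L ≤ 2 * μ := by
  rw [gam, div_le_iff₀ (by positivity)]
  nlinarith [mul_pos hμ hμ]

theorem le_gam (hμ : 0 < μ) (hμL : μ ≤ L) : μ ≤ gam μ L := by
  rw [gam, le_div_iff₀ (by linarith)]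
  nlinarith

theorem stepBound_pos (hM : 0 < M) (hμ : 0 < μ) (hL : 0 < L) : 0 < stepBound M μ L := by
  have hM' : (0 : ℝ) < M := by exact_mod_cast hM
  have hg := gam_pos hμ hL
  rw [stepBound]
  split_ifs with h
  · positivity
  · have h1 : (0 : ℝ) < (M : ℝ) - 1 := by
      have : (1 : ℝ) < M := by exact_mod_cast (by omega : 1 < M)
      linarith
    refine lt_min (lt_min ?_ ?_) (lt_min ?_ ?_)
    · positivity
    · positivity
    · exact Real.sqrt_pos.2 (by positivity)
    · exact Real.rpow_pos_of_pos (by positivity) _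

/-- The step sizes have the form `1 / (c k + 1 / D)` that the next lemmas treat. -/
theorem stepSize_eq (k : ℕ) : stepSize p ps M μ L k
    = 1 / (pMin p ps * M * gam μ L / 48 * k + 1 / stepBound M μ L) := by
  rw [stepSize]
  congr 2
  ring

variable {c D : ℝ}

theorem harmonicStep_pos (hc : 0 < c) (hD : 0 < D) (k : ℕ) : 0 < 1 / (c * k + 1 / D) := by
  positivity

theorem harmonicStep_le (hc : 0 < c) (hD : 0 < D) (k : ℕ) : 1 / (c * k + 1 / D) ≤ D := by
  rw [div_le_iff₀ (by positivity)]
  have h : D * (1 / D) = 1 := by field_simp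
  have : 0 ≤ D * (c * k) := by positivity
  linarith

theorem harmonicStep_le_div (hc : 0 < c) (hD : 0 < D) {k : ℕ} (hk : 0 < k) :
    1 / (c * k + 1 / D) ≤ 1 / (c * k) := by
  have hk' : (0 : ℝ) < k := by exact_mod_cast hk
  have : 0 ≤ 1 / D := by positivity
  gcongr
  linarith

theorem le_harmonicStep (hc : 0 < c) (hD : 0 < D) {k : ℕ} (hk : 8 / (c * D) ≤ k) :
    8 / (9 * (c * k)) ≤ 1 / (c * k + 1 / D) := by
  have hk' : (0 : ℝ) < k := lt_of_lt_of_le (by positivity) hk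
  rw [div_le_div_iff₀ (by positivity) (by positivity)]
  have h : 1 / D * 8 ≤ c * k := by
    rw [div_le_iff₀ (by positivity)] at hk
    rw [one_div_mul_eq_div, div_le_iff₀ hD]
    linarith
  linarith

theorem harmonicStep_sub_le (hc : 0 < c) (hD : 0 < D) {k : ℕ} (hk : 0 < k) :
    1 / (c * k + 1 / D) - 1 / (c * (k + 1 : ℕ) + 1 / D) ≤ 1 / (c * k * (k + 1 : ℕ)) := by
  have hk' : (0 : ℝ) < k := by exact_mod_cast hk
  have h1 := harmonicStep_le_div hc hD hk
  have h2 := harmonicStep_le_div hc hD (Nat.succ_pos k)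
  have h3 := (harmonicStep_pos hc hD (k + 1)).le
  have h4 : 1 / (c * k + 1 / D) - 1 / (c * (k + 1 : ℕ) + 1 / D)
      = c * (1 / (c * k + 1 / D) * (1 / (c * (k + 1 : ℕ) + 1 / D))) := by
    have a1 : c * k + 1 / D ≠ 0 := by positivity
    have a2 : c * (k + 1 : ℕ) + 1 / D ≠ 0 := by positivity
    rw [div_sub_div _ _ a1 a2, ← mul_div_mul_comm, mul_one, ← mul_div_assoc]
    push_cast
    congr 1
    ring
  rw [h4]
  calc c * (1 / (c * k + 1 / D) * (1 / (c * (k + 1 : ℕ) + 1 / D)))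
      ≤ c * (1 / (c * k) * (1 / (c * (k + 1 : ℕ)))) := by
        have : 0 ≤ 1 / (c * (k : ℝ)) := by positivity
        gcongr
    _ = 1 / (c * k * (k + 1 : ℕ)) := by
        push_cast
        field_simp

end StepSize

/-! ### Decrease of the Lyapunov function along the algorithm -/

section Decrease

variable {Ω : Type*} [mΩ : MeasurableSpace Ω] {P : Measure Ω} {n d M : ℕ}
  {f : Fin n → EuclideanSpace ℝ (Fin d) → ℝ} {σ ps L μ : ℝ} {p : Fin n → ℝ} {α : ℕ → ℝ}
  {x₀ : EuclideanSpace ℝ (Fin d)} {J : ℕ → Ω → Option (Fin n)}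
  {G : ℕ → Fin n → ℕ → Ω → EuclideanSpace ℝ (Fin d)}

/-- The point with which the memory and the local result of client `i` are compared when the current
step size is `a`: the result of one step of length `M a` from `x` along the gradient at `x`. -/
noncomputable abbrev target (f : Fin n → EuclideanSpace ℝ (Fin d) → ℝ) (M : ℕ)
    (x : EuclideanSpace ℝ (Fin d)) (a : ℝ) (i : Fin n) : EuclideanSpace ℝ (Fin d) :=
  x - (M * a) • gradient (f i) x

/-- The Lyapunov function with weight parameter `s` and all clients compared with the targets for
the step size `a`. -/
noncomputable def energy (P : Measure Ω) (f : Fin n → EuclideanSpace ℝ (Fin d) → ℝ)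
    (p : Fin n → ℝ) (ps : ℝ) (M : ℕ) (x : EuclideanSpace ℝ (Fin d)) (S : Ω → State n d)
    (s a : ℝ) : ℝ :=
  lyapunov p ps s (meanSq P (fun ω => (S ω).xs) x)
    (fun i => meanSq P (fun ω => (S ω).y i) (target f M x a i))
    (fun i => meanSq P (fun ω => (S ω).loc i) (target f M x a i))

/-- The targets average to the minimizer. -/
theorem average_target (hn : 0 < n) {x : EuclideanSpace ℝ (Fin d)}
    (hx : ∑ i, gradient (f i) x = 0) (a : ℝ) :
    (1 / (n : ℝ)) • ∑ i, target f M x a i = x := by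
  rw [Finset.sum_sub_distrib, ← Finset.smul_sum, hx, smul_zero, sub_zero, average_const hn]

theorem energy_nonneg (hp : ∀ i, 0 < p i) (hps : 0 < ps) {s : ℝ} (hs : s < 1)
    (x : EuclideanSpace ℝ (Fin d)) (S : Ω → State n d) (a : ℝ) :
    0 ≤ energy P f p ps M x S s a :=
  lyapunov_nonneg hp hps hs (meanSq_nonneg _ _) (fun _ => meanSq_nonneg _ _)
    fun _ => meanSq_nonneg _ _

theorem norm_target_sub_target_sq_le {x : EuclideanSpace ℝ (Fin d)} {a b B : ℝ} (hab : a ≤ b)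
    {i : Fin n} (hB : ‖gradient (f i) x‖ ≤ B) :
    ‖target f M x b i - target f M x a i‖ ^ 2 ≤ (M * (b - a) * B) ^ 2 := by
  have e : target f M x b i - target f M x a i = -((M * (b - a)) • gradient (f i) x) := by
    simp only [target]
    rw [sub_sub_sub_cancel_left, ← sub_smul, ← neg_smul]
    congr 1
    ring
  have h0 : 0 ≤ (M : ℝ) * (b - a) := mul_nonneg (by positivity) (by linarith)
  rw [e, norm_neg, norm_smul, Real.norm_of_nonneg h0]
  gcongr

variable [IsProbabilityMeasure P]

/-- The price of moving the targets and decreasing the weights. -/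
theorem energy_le_of_le (hn : 0 < n) (hp : ∀ i, 0 < p i) (hps : 0 < ps)
    {x : EuclideanSpace ℝ (Fin d)} {B : ℝ} (hB : ∀ i, ‖gradient (f i) x‖ ≤ B) {S : Ω → State n d}
    (hy : ∀ i, MemLp (fun ω => (S ω).y i) 2 P) (hl : ∀ i, MemLp (fun ω => (S ω).loc i) 2 P)
    {s t a b ε : ℝ} (hst : s ≤ t) (ht : t ≤ 1 / 9) (hab : a ≤ b) (hε : 0 < ε) :
    energy P f p ps M x S s a ≤ (1 + ε) * energy P f p ps M x S t b
      + 3 * qBar p * ((1 + 1 / ε) * (M * (b - a) * B) ^ 2) := by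
  have hshift : ∀ {F : Ω → EuclideanSpace ℝ (Fin d)}, MemLp F 2 P → ∀ i,
      meanSq P F (target f M x a i) ≤ (1 + ε) * meanSq P F (target f M x b i)
        + (1 + 1 / ε) * (M * (b - a) * B) ^ 2 := fun {F} hF i =>
    (meanSq_le_young hF (target f M x b i) _ hε).trans
      (add_le_add le_rfl (mul_le_mul_of_nonneg_left (norm_target_sub_target_sq_le hab (hB i))
        (by positivity)))
  refine (lyapunov_le_of_shift hp hps (hst.trans ht) hε.le (by positivity)
    (meanSq_nonneg (fun ω => (S ω).xs) x) (fun i => hshift (hy i) i)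
    fun i => hshift (hl i) i).trans (add_le_add (mul_le_mul_of_nonneg_left ?_ (by positivity))
    le_rfl)
  exact lyapunov_mono_weight hn hp hst (by linarith)
    (fun i => meanSq_nonneg _ _) fun i => meanSq_nonneg _ _

/-- Decrease of the Lyapunov function in one iteration, for weights and targets that belong to the
new step size. -/
theorem StochasticModel.energy_succ_le_energy (h : StochasticModel P f σ p ps M α x₀ J G)
    (hn : 0 < n) (hM : 0 < M) (hμ : 0 < μ) (hL : 0 < L) (hp : ∀ i, 0 < p i) (hps : 0 < ps)
    {pm : ℝ} (hpm : ∀ i, pm ≤ p i) (hpms : pm ≤ ps)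
    (hs : ∀ i, IsSmooth L (f i)) (hc : ∀ i, IsStronglyConvex μ (f i))
    {x : EuclideanSpace ℝ (Fin d)} (hx : ∑ i, gradient (f i) x = 0) {B : ℝ}
    (hB : ∀ i, ‖gradient (f i) x‖ ≤ B) (k : ℕ) {a s b : ℝ} (ha : α (k + 1) = a) (ha0 : 0 < a)
    (haL : a * L ^ 2 ≤ μ / 2) (haM : M * (μ * a) ≤ 4 / 9) (hsa : s = M * (μ * a) / 4)
    (hb : b = a ^ 2 * L * B * (M * (M - 1) / 2)) :
    energy P f p ps M x (randomState M α x₀ J G (k + 1)) s a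
      ≤ (1 - pm * s) * energy P f p ps M x (randomState M α x₀ J G k) s a
        + (1 / (1 - s)) ^ 2 * ((1 + s) * (M * (a ^ 2 * σ ^ 2)) + (1 + 1 / s) * b ^ 2) := by
  have hM1 : (1 : ℝ) ≤ M := by exact_mod_cast hM
  have hs0 : 0 < s := by
    rw [hsa]
    positivity
  have hμa := mul_pos hμ ha0
  have hμa1 : μ * a ≤ 4 / 9 := by nlinarith
  have hstep : 1 - 2 * a * μ + a ^ 2 * L ^ 2 ≤ 1 - 3 / 2 * (μ * a) := by nlinarith
  have hbB : ∀ i, a ^ 2 * L * ‖gradient (f i) x‖ * (M * (M - 1) / 2) ≤ b := fun i => by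
    have h1 : (0 : ℝ) ≤ M * (M - 1) / 2 := by
      have : (0 : ℝ) ≤ (M : ℝ) - 1 := by linarith
      positivity
    rw [hb]
    have := hB i
    gcongr
  have hpow := one_add_mul_pow_le (M := M) hμa.le haM hM
  rw [← hsa] at hpow
  refine lyapunov_succ_le hn hp hps hpm hpms hs0.le (by linarith) (meanSq_nonneg _ _)
    (fun i => meanSq_nonneg _ _) (fun i => meanSq_nonneg _ _)
    (h.meanSq_xs_succ_le hn hs hps k (average_target (M := M) hn hx a))
    (fun i => (h.meanSq_y_succ hn hs hp k i (target f M x a i)).le) fun i => ?_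
  subst ha
  have h1 := h.meanSq_loc_succ_le hn hL.le hs hc hp k ha0.le
    (by linarith : 0 ≤ 1 - 3 / 2 * (μ * α (k + 1))) (by linarith) hstep (by linarith) i x hs0
    (hbB i)
  refine h1.trans ?_
  have h2 := mul_le_mul_of_nonneg_right hpow
    (meanSq_nonneg (P := P) (fun ω => (randomState M α x₀ J G k ω).xs) x)
  have h3 := mul_le_mul_of_nonneg_left h2 (hp i).le
  linarith

/-- Decrease of the Lyapunov function in one iteration. The three sources are the motion of the
targets, the gradient noise, and the drift of the local training away from a straight line. -/
theorem StochasticModel.energy_succ_le (h : StochasticModel P f σ p ps M α x₀ J G)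
    (hn : 0 < n) (hM : 0 < M) (hμ : 0 < μ) (hL : 0 < L) (hp : ∀ i, 0 < p i) (hps : 0 < ps)
    {pm : ℝ} (hpm0 : 0 < pm) (hpm1 : pm ≤ 1) (hpm : ∀ i, pm ≤ p i) (hpms : pm ≤ ps)
    (hs : ∀ i, IsSmooth L (f i)) (hc : ∀ i, IsStronglyConvex μ (f i))
    {x : EuclideanSpace ℝ (Fin d)} (hx : ∑ i, gradient (f i) x = 0) {B : ℝ}
    (hB : ∀ i, ‖gradient (f i) x‖ ≤ B) (k : ℕ) (hα0 : 0 < α (k + 1))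
    (hαα : α (k + 1) ≤ α k) (hαL : α (k + 1) * L ^ 2 ≤ μ / 2)
    (hαM : M * (μ * α k) ≤ 4 / 9) :
    energy P f p ps M x (randomState M α x₀ J G (k + 1)) (M * (μ * α (k + 1)) / 4) (α (k + 1))
      ≤ (1 - 3 / 4 * (pm * (M * (μ * α (k + 1)) / 4)))
          * energy P f p ps M x (randomState M α x₀ J G k) (M * (μ * α k) / 4) (α k)
        + 12 * qBar p * (M * (α k - α (k + 1)) * B) ^ 2
            / (pm * (M * (μ * α (k + 1)) / 4))
        + 3 / 2 * (M * (α (k + 1) ^ 2 * σ ^ 2))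
        + 3 / 2 * (α (k + 1) ^ 2 * L * B * (M * (M - 1) / 2)) ^ 2
            / (M * (μ * α (k + 1)) / 4) := by
  have hM0 : (0 : ℝ) < M := by exact_mod_cast hM
  have hs0 : 0 < M * (μ * α (k + 1)) / 4 := by positivity
  have hst : M * (μ * α (k + 1)) / 4 ≤ M * (μ * α k) / 4 := by gcongr
  have hLp := h.memLp_randomState hn hs k
  refine contraction_combine (mul_pos hpm0 hs0) (by nlinarith) hs0 (by linarith) (qBar_nonneg hp)
    (sq_nonneg _) (by positivity) (energy_nonneg hp hps (by linarith) x _ _)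
    (energy_le_of_le hn hp hps hB hLp.2.1 hLp.2.2 hst (by linarith) hαα (by positivity))
    (h.energy_succ_le_energy hn hM hμ hL hp hps hpm hpms hs hc hx hB k rfl hα0 hαL
      (by linarith) rfl rfl)

end Decrease

/-! ### Comparison with the rate -/

section Comparison

/-- The sources in the decrease of the Lyapunov function for step sizes of order
`1 / (pm M μ j)`: the noise is of order `j⁻²`, target motion and drift are of order `j⁻³`. -/
theorem decrease_le_of_stepSize {M pm μ L q B σ j x y E : ℝ} (hM : 1 ≤ M) (hpm : 0 < pm)
    (hμ : 0 < μ) (hq : 0 ≤ q) (hB : 0 ≤ B) (hj : 0 < j) (hE : 0 ≤ E)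
    (hx1 : 64 / 3 / (pm * M * μ * j) ≤ x) (hx2 : x ≤ 48 / (pm * M * μ * j)) (hxy : x ≤ y)
    (hyx : y - x ≤ 96 / (pm * M * μ * j ^ 2)) :
    (1 - 3 / 4 * (pm * (M * (μ * x) / 4))) * E
        + 12 * q * (M * (y - x) * B) ^ 2 / (pm * (M * (μ * x) / 4))
        + 3 / 2 * (M * (x ^ 2 * σ ^ 2))
        + 3 / 2 * (x ^ 2 * L * B * (M * (M - 1) / 2)) ^ 2 / (M * (μ * x) / 4)
      ≤ (1 - 4 / j) * E + 3456 * σ ^ 2 / (pm ^ 2 * M * μ ^ 2) / j ^ 2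
        + (20736 * q * B ^ 2 / (pm ^ 2 * μ ^ 2)
          + 165888 * L ^ 2 * B ^ 2 * (1 - 1 / M) ^ 2 / (pm ^ 3 * μ ^ 4)) / j ^ 3 := by
  have hM0 : 0 < M := by linarith
  have hx0 : 0 < x := lt_of_lt_of_le (by positivity) hx1
  have hr : 16 / (3 * j) ≤ pm * (M * (μ * x) / 4) := by
    rw [div_le_iff₀ (by positivity)] at hx1 ⊢
    linarith
  have h1 : (1 - 3 / 4 * (pm * (M * (μ * x) / 4))) * E ≤ (1 - 4 / j) * E := by
    refine mul_le_mul_of_nonneg_right ?_ hE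
    have : 3 / 4 * (16 / (3 * j)) = 4 / j := by
      field_simp
      norm_num
    linarith
  have h2 : 12 * q * (M * (y - x) * B) ^ 2 / (pm * (M * (μ * x) / 4))
      ≤ 20736 * q * B ^ 2 / (pm ^ 2 * μ ^ 2) / j ^ 3 := by
    have hyx0 : 0 ≤ y - x := by linarith
    calc 12 * q * (M * (y - x) * B) ^ 2 / (pm * (M * (μ * x) / 4))
        ≤ 12 * q * (M * (96 / (pm * M * μ * j ^ 2)) * B) ^ 2 / (16 / (3 * j)) := by gcongr
      _ = 20736 * q * B ^ 2 / (pm ^ 2 * μ ^ 2) / j ^ 3 := by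
        field_simp
        ring
  have h3 : 3 / 2 * (M * (x ^ 2 * σ ^ 2)) ≤ 3456 * σ ^ 2 / (pm ^ 2 * M * μ ^ 2) / j ^ 2 := by
    calc 3 / 2 * (M * (x ^ 2 * σ ^ 2))
        ≤ 3 / 2 * (M * ((48 / (pm * M * μ * j)) ^ 2 * σ ^ 2)) := by gcongr
      _ = 3456 * σ ^ 2 / (pm ^ 2 * M * μ ^ 2) / j ^ 2 := by
        field_simp
        ring
  have h4 : 3 / 2 * (x ^ 2 * L * B * (M * (M - 1) / 2)) ^ 2 / (M * (μ * x) / 4)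
      ≤ 165888 * L ^ 2 * B ^ 2 * (1 - 1 / M) ^ 2 / (pm ^ 3 * μ ^ 4) / j ^ 3 := by
    calc 3 / 2 * (x ^ 2 * L * B * (M * (M - 1) / 2)) ^ 2 / (M * (μ * x) / 4)
        = x ^ 3 * (3 / 2 * L ^ 2 * B ^ 2 * M * (M - 1) ^ 2 / μ) := by
          field_simp
          ring
      _ ≤ (48 / (pm * M * μ * j)) ^ 3 * (3 / 2 * L ^ 2 * B ^ 2 * M * (M - 1) ^ 2 / μ) := by
          gcongr
      _ = 165888 * L ^ 2 * B ^ 2 * (1 - 1 / M) ^ 2 / (pm ^ 3 * μ ^ 4) / j ^ 3 := by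
          field_simp
          ring
  rw [add_div]
  linarith

/-- The leading parts of the first and of the last term of the rate. -/
theorem leading_le_rate {n M : ℕ} {p : Fin n → ℝ} {ps μ L σ ζ : ℝ} (hn : 0 < n) (hM : 0 < M)
    (hp : ∀ i, 0 < p i) (hps : 0 < ps) (hμ : 0 < μ) (hL : 0 < L) (hσ : 0 ≤ σ) (hζ : 0 ≤ ζ)
    (K : ℕ) :
    ps / pMin p ps * σ ^ 2 / (pMin p ps * M * K)
      + ps / pMin p ps * (1 - 1 / (M : ℝ) + Real.sqrt (pMin p ps) * qBar p) * L ^ 4 * ζ ^ 2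
        / (pMin p ps ^ 2 * (K : ℝ) ^ 2) ≤ rate p ps M μ L σ ζ K := by
  have hpm := pMin_pos hn hp hps
  have hδ : 0 ≤ 1 - 1 / (M : ℝ) := by
    rw [sub_nonneg, div_le_one (by exact_mod_cast hM)]
    exact_mod_cast hM
  have h1 : ps / pMin p ps * σ ^ 2 / (pMin p ps * M * K)
      ≤ ps / pMin p ps * (1 + (1 - 1 / (M : ℝ)) * (L / μ)) * σ ^ 2 / (pMin p ps * M * K) := by
    have h2 : 1 ≤ 1 + (1 - 1 / (M : ℝ)) * (L / μ) := by
      have : 0 ≤ (1 - 1 / (M : ℝ)) * (L / μ) := by positivity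
      linarith
    have h3 : ps / pMin p ps ≤ ps / pMin p ps * (1 + (1 - 1 / (M : ℝ)) * (L / μ)) :=
      le_mul_of_one_le_right (by positivity) h2
    gcongr
  have h4 : 0 ≤ ps / pMin p ps * Real.sqrt (qBar p) * L
      * Real.sqrt (1 + (1 - 1 / (M : ℝ)) * (L / μ)) * σ * ζ
        / (pMin p ps * Real.sqrt M * (K : ℝ) ^ (3 / 2 : ℝ)) := by positivity
  have h5 : 0 ≤ ps / pMin p ps * Real.sqrt (qBar p) * L ^ (3 / 2 : ℝ) * Real.sqrt (σ * ζ ^ 3)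
        / (Real.sqrt (pMin p ps) * (K : ℝ) ^ (3 / 2 : ℝ)) := by positivity
  simp only [rate]
  linarith

/-- The errors are bounded by the leading parts of the rate. The noise costs the factor `1152`,
target motion `10368` and drift `82944`, and `K` is so large that the transient, of order `T K⁻³`,
costs at most one more unit of the noise and of the target motion. -/
theorem bound_le_leading {pm ps M μ L q δ σ ζ K A B T : ℝ} (hpm : 0 < pm) (hpm1 : pm ≤ 1)
    (hps : 0 < ps) (hM : 1 ≤ M) (hμ : 0 < μ) (hμL : μ ≤ L) (hq : 0 < q) (hδ0 : 0 ≤ δ) (hδ1 : δ ≤ 1)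
    (hK1 : 1 ≤ K)
    (hA : A = 3456 * σ ^ 2 / (pm ^ 2 * M * μ ^ 2))
    (hB : B = 20736 * q * (L * ζ) ^ 2 / (pm ^ 2 * μ ^ 2)
      + 165888 * L ^ 2 * (L * ζ) ^ 2 * δ ^ 2 / (pm ^ 3 * μ ^ 4))
    (hK2 : ps * T / (ps / pm / (pm * M)) ≤ K)
    (hK3 : ps * T / (ps / pm * (Real.sqrt pm * q) * L ^ 4 / pm ^ 2) ≤ K) :
    ps * (A / (3 * K) + B / (2 * K ^ 2) + T * (σ ^ 2 + ζ ^ 2) / K ^ 3)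
      ≤ 100000 * max 1 (1 / μ ^ 4) * (ps / pm * σ ^ 2 / (pm * M * K)
        + ps / pm * (δ + Real.sqrt pm * q) * L ^ 4 * ζ ^ 2 / (pm ^ 2 * K ^ 2)) := by
  have hL : 0 < L := by linarith
  have hK : 0 < K := by linarith
  have hM0 : 0 < M := by linarith
  set w := Real.sqrt pm with hw
  have hw0 : 0 < w := Real.sqrt_pos.2 hpm
  have hw1 : pm ≤ w := by
    have h1 : w ^ 2 = pm := Real.sq_sqrt hpm.le
    have h2 : w ≤ 1 := Real.sqrt_le_one.2 hpm1
    nlinarith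
  set m := max 1 (1 / μ ^ 4) with hm
  have hm1 : 1 ≤ m := le_max_left _ _
  have hm4 : 1 / μ ^ 4 ≤ m := le_max_right _ _
  have hm2 : 1 / μ ^ 2 ≤ m := by
    have h1 : (1 / μ ^ 2) ^ 2 = 1 / μ ^ 4 := by
      rw [div_pow, one_pow, ← pow_mul]
    nlinarith [sq_nonneg (1 / μ ^ 2 - 1)]
  set T1 := ps / pm * σ ^ 2 / (pm * M * K) with hT1
  set T2 := ps / pm * δ * L ^ 4 * ζ ^ 2 / (pm ^ 2 * K ^ 2) with hT2
  set T3 := ps / pm * (w * q) * L ^ 4 * ζ ^ 2 / (pm ^ 2 * K ^ 2) with hT3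
  have hT10 : 0 ≤ T1 := by positivity
  have hT20 : 0 ≤ T2 := by positivity
  have hT30 : 0 ≤ T3 := by positivity
  have hsplit : ps / pm * (δ + w * q) * L ^ 4 * ζ ^ 2 / (pm ^ 2 * K ^ 2) = T2 + T3 := by
    rw [hT2, hT3]
    ring
  have h1 : ps * (A / (3 * K)) ≤ 1152 * (m * T1) := by
    have : ps * (A / (3 * K)) = 1152 * (1 / μ ^ 2 * T1) := by
      rw [hA, hT1]
      field_simp
      ring
    rw [this]
    gcongr
  have h2 : ps * ((20736 * q * (L * ζ) ^ 2 / (pm ^ 2 * μ ^ 2)) / (2 * K ^ 2))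
      ≤ 10368 * (m * T3) := by
    have e1 : ps * ((20736 * q * (L * ζ) ^ 2 / (pm ^ 2 * μ ^ 2)) / (2 * K ^ 2))
        = 10368 * (ps / pm * q * ζ ^ 2 / (pm ^ 2 * K ^ 2)) * (L ^ 2 / μ ^ 2 * pm) := by
      field_simp
      ring
    have e2 : 10368 * (1 / μ ^ 4 * T3)
        = 10368 * (ps / pm * q * ζ ^ 2 / (pm ^ 2 * K ^ 2)) * ((L ^ 2 / μ ^ 2) ^ 2 * w) := by
      rw [hT3]
      field_simp
    have e3 : L ^ 2 / μ ^ 2 ≤ (L ^ 2 / μ ^ 2) ^ 2 := by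
      have : 1 ≤ L ^ 2 / μ ^ 2 := by
        rw [one_le_div (by positivity)]
        gcongr
      nlinarith
    calc ps * ((20736 * q * (L * ζ) ^ 2 / (pm ^ 2 * μ ^ 2)) / (2 * K ^ 2))
        ≤ 10368 * (1 / μ ^ 4 * T3) := by
          rw [e1, e2]
          gcongr
      _ ≤ 10368 * (m * T3) := by gcongr
  have h3 : ps * ((165888 * L ^ 2 * (L * ζ) ^ 2 * δ ^ 2 / (pm ^ 3 * μ ^ 4)) / (2 * K ^ 2))
      ≤ 82944 * (m * T2) := by
    have e1 : ps * ((165888 * L ^ 2 * (L * ζ) ^ 2 * δ ^ 2 / (pm ^ 3 * μ ^ 4)) / (2 * K ^ 2))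
        = δ * (82944 * (1 / μ ^ 4 * T2)) := by
      rw [hT2]
      field_simp
      ring
    calc ps * ((165888 * L ^ 2 * (L * ζ) ^ 2 * δ ^ 2 / (pm ^ 3 * μ ^ 4)) / (2 * K ^ 2))
        ≤ 1 * (82944 * (1 / μ ^ 4 * T2)) := by
          rw [e1]
          gcongr
      _ ≤ 82944 * (m * T2) := by
          rw [one_mul]
          gcongr
  have h4 : ps * (T * σ ^ 2 / K ^ 3) ≤ m * T1 := by
    rw [div_le_iff₀ (by positivity)] at hK2
    have e1 : ps * (T * σ ^ 2 / K ^ 3) ≤ T1 / K := by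
      calc ps * (T * σ ^ 2 / K ^ 3) = ps * T * (σ ^ 2 / K ^ 3) := by ring
        _ ≤ K * (ps / pm / (pm * M)) * (σ ^ 2 / K ^ 3) := by gcongr
        _ = T1 / K := by
          rw [hT1]
          field_simp
    calc ps * (T * σ ^ 2 / K ^ 3) ≤ T1 / K := e1
      _ ≤ T1 := div_le_self hT10 hK1
      _ ≤ m * T1 := le_mul_of_one_le_left hT10 hm1
  have h5 : ps * (T * ζ ^ 2 / K ^ 3) ≤ m * T3 := by
    rw [div_le_iff₀ (by positivity)] at hK3
    calc ps * (T * ζ ^ 2 / K ^ 3) = ps * T * (ζ ^ 2 / K ^ 3) := by ring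
      _ ≤ K * (ps / pm * (w * q) * L ^ 4 / pm ^ 2) * (ζ ^ 2 / K ^ 3) := by gcongr
      _ = T3 := by
        rw [hT3]
        field_simp
      _ ≤ m * T3 := le_mul_of_one_le_left hT30 hm1
  have h6 : ps * (A / (3 * K) + B / (2 * K ^ 2) + T * (σ ^ 2 + ζ ^ 2) / K ^ 3)
      = ps * (A / (3 * K)) + ps * ((20736 * q * (L * ζ) ^ 2 / (pm ^ 2 * μ ^ 2)) / (2 * K ^ 2))
        + ps * ((165888 * L ^ 2 * (L * ζ) ^ 2 * δ ^ 2 / (pm ^ 3 * μ ^ 4)) / (2 * K ^ 2))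
        + ps * (T * σ ^ 2 / K ^ 3) + ps * (T * ζ ^ 2 / K ^ 3) := by
    rw [hB]
    ring
  rw [h6, hsplit]
  have hmT1 : 0 ≤ m * T1 := by positivity
  have hmT2 : 0 ≤ m * T2 := by positivity
  have hmT3 : 0 ≤ m * T3 := by positivity
  linarith

end Comparison

/-! ### The convergence rate -/

section Convergence

variable {Ω : Type*} [mΩ : MeasurableSpace Ω] {P : Measure Ω} {n d M : ℕ}
  {f : Fin n → EuclideanSpace ℝ (Fin d) → ℝ} {σ ps L μ : ℝ} {p : Fin n → ℝ} {α : ℕ → ℝ}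
  {x₀ : EuclideanSpace ℝ (Fin d)} {J : ℕ → Ω → Option (Fin n)}
  {G : ℕ → Fin n → ℕ → Ω → EuclideanSpace ℝ (Fin d)}

theorem server_le_energy (hp : ∀ i, 0 < p i) (hps : 0 < ps) {s : ℝ} (hs : s < 1)
    (x : EuclideanSpace ℝ (Fin d)) (S : Ω → State n d) (a : ℝ) :
    meanSq P (fun ω => (S ω).xs) x ≤ ps * energy P f p ps M x S s a := by
  have h0 := lyapunov_nonneg (X := 0) hp hps hs le_rfl
    (fun i => meanSq_nonneg (P := P) (fun ω => (S ω).y i) (target f M x a i))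
    fun i => meanSq_nonneg (P := P) (fun ω => (S ω).loc i) (target f M x a i)
  have h1 : energy P f p ps M x S s a = meanSq P (fun ω => (S ω).xs) x / ps
      + lyapunov p ps s 0 (fun i => meanSq P (fun ω => (S ω).y i) (target f M x a i))
        fun i => meanSq P (fun ω => (S ω).loc i) (target f M x a i) := by
    rw [energy, lyapunov, lyapunov]
    ring
  have h2 : ps * (meanSq P (fun ω => (S ω).xs) x / ps) = meanSq P (fun ω => (S ω).xs) x := by
    field_simp
  rw [h1, mul_add, h2]
  nlinarith

variable [IsProbabilityMeasure P]

/-- The Lyapunov function is controlled by the mean square distances to `x`. -/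
theorem energy_le_of_meanSq_le (hp : ∀ i, 0 < p i) (hps : 0 < ps)
    {x : EuclideanSpace ℝ (Fin d)} {S : Ω → State n d} {s a B R : ℝ} (hs : s ≤ 1 / 9)
    (ha : 0 ≤ a) (hB : ∀ i, ‖gradient (f i) x‖ ≤ B) (hR : 0 ≤ R)
    (hy : ∀ i, MemLp (fun ω => (S ω).y i) 2 P) (hl : ∀ i, MemLp (fun ω => (S ω).loc i) 2 P)
    (hxR : meanSq P (fun ω => (S ω).xs) x ≤ R)
    (hyR : ∀ i, meanSq P (fun ω => (S ω).y i) x ≤ R)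
    (hlR : ∀ i, meanSq P (fun ω => (S ω).loc i) x ≤ R) :
    energy P f p ps M x S s a ≤ R / ps + 3 * qBar p * (2 * R + 2 * (M * a * B) ^ 2) := by
  have hT : ∀ {F : Ω → EuclideanSpace ℝ (Fin d)}, MemLp F 2 P → meanSq P F x ≤ R → ∀ i,
      meanSq P F (target f M x a i) ≤ (1 + 0) * 0 + (2 * R + 2 * (M * a * B) ^ 2) := by
    intro F hF hFR i
    have h1 := meanSq_le_young hF x (target f M x a i) one_pos
    have h2 : ‖x - target f M x a i‖ ^ 2 ≤ (M * a * B) ^ 2 := by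
      rw [target, sub_sub_cancel, norm_smul, Real.norm_of_nonneg (by positivity)]
      have := hB i
      gcongr
    linarith
  have h := lyapunov_le_of_shift (Y := fun _ => 0) (Z := fun _ => 0) hp hps hs le_rfl
    (by positivity) (meanSq_nonneg (P := P) (fun ω => (S ω).xs) x)
    (fun i => hT (hy i) (hyR i) i) (fun i => hT (hl i) (hlR i) i)
  have h0 : lyapunov p ps s (meanSq P (fun ω => (S ω).xs) x) (fun _ => 0) (fun _ => 0)
      = meanSq P (fun ω => (S ω).xs) x / ps := by
    simp [lyapunov]
  rw [h0] at h
  have h3 : meanSq P (fun ω => (S ω).xs) x / ps ≤ R / ps := by gcongr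
  rw [energy]
  linarith

/-- Bound on the Lyapunov function at the iteration from which on the step sizes are small, relative
to `max σ ζ ^ 2`. -/
noncomputable def initialEnergy (p : Fin n → ℝ) (ps : ℝ) (M : ℕ) (L a ρ : ℝ) (k : ℕ) : ℝ :=
  crudeBound M L a ρ k / ps
    + 3 * qBar p * (2 * crudeBound M L a ρ k + 2 * (M * a * L) ^ 2)

theorem StochasticModel.energy_le_initialEnergy (h : StochasticModel P f σ p ps M α x₀ J G)
    (hn : 0 < n) (hL : 0 ≤ L) (hp : ∀ i, 0 < p i) (hps : 0 < ps) (hs : ∀ i, IsSmooth L (f i))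
    {a ρ D ζ : ℝ} (hα : ∀ k, 0 ≤ α k) (ha : ∀ k, α k ≤ a) {x : EuclideanSpace ℝ (Fin d)}
    (hζ : ∀ i, ‖gradient (f i) x‖ ≤ L * ζ) (hζD : ζ ^ 2 ≤ D) (hσ : σ ^ 2 ≤ D)
    (hx : ‖x₀ - x‖ ^ 2 ≤ ρ ^ 2 * D) {s : ℝ} (hs9 : s ≤ 1 / 9) (k : ℕ) :
    energy P f p ps M x (randomState M α x₀ J G k) s (α k)
      ≤ initialEnergy p ps M L a ρ k * D := by
  have hD : 0 ≤ D := (sq_nonneg σ).trans hσ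
  have hg : ∀ i, ‖gradient (f i) x‖ ^ 2 ≤ L ^ 2 * D := fun i => by
    calc ‖gradient (f i) x‖ ^ 2 ≤ (L * ζ) ^ 2 := by
          have := hζ i
          gcongr
      _ = L ^ 2 * ζ ^ 2 := by ring
      _ ≤ L ^ 2 * D := by gcongr
  have hLp := h.memLp_randomState hn hs k
  have hB := h.meanSq_le_crudeBound hn hs hα ha hg hσ hx k
  refine (energy_le_of_meanSq_le hp hps hs9 (hα k) hζ
    (mul_nonneg (crudeBound_nonneg M k) hD) hLp.2.1 hLp.2.2 hB.1 hB.2.1 hB.2.2).trans ?_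
  have h1 : (M * α k * (L * ζ)) ^ 2 ≤ (M * a * L) ^ 2 * D := by
    calc (M * α k * (L * ζ)) ^ 2 = (M * α k * L) ^ 2 * ζ ^ 2 := by ring
      _ ≤ (M * a * L) ^ 2 * D := by
        have h2 := hα k
        have h3 := ha k
        gcongr
  have h2 := mul_le_mul_of_nonneg_left h1 (qBar_nonneg hp)
  have h3 : initialEnergy p ps M L a ρ k * D = crudeBound M L a ρ k * D / ps
      + 3 * qBar p * (2 * (crudeBound M L a ρ k * D)) + 6 * (qBar p * ((M * a * L) ^ 2 * D)) := by
    rw [initialEnergy]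
    ring
  linarith

theorem initialEnergy_nonneg (hp : ∀ i, 0 < p i) (hps : 0 < ps) (a ρ : ℝ) (k : ℕ) :
    0 ≤ initialEnergy p ps M L a ρ k := by
  have := crudeBound_nonneg M (L := L) (a := a) (ρ := ρ) k
  have := qBar_nonneg hp
  rw [initialEnergy]
  positivity

/-- An iteration from which on the step sizes are small and essentially harmonic. -/
theorem exists_burnIn (M : ℕ) (μ L c D : ℝ) :
    ∃ k₁ : ℕ, 4 ≤ k₁ ∧ 8 / (c * D) ≤ k₁ ∧ L ^ 2 * 2 / (c * μ) ≤ k₁ ∧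
      M * μ * 9 / (4 * c) ≤ k₁ := by
  obtain ⟨a, ha⟩ := exists_nat_ge (8 / (c * D))
  obtain ⟨b, hb⟩ := exists_nat_ge (L ^ 2 * 2 / (c * μ))
  obtain ⟨e, he⟩ := exists_nat_ge (M * μ * 9 / (4 * c))
  refine ⟨4 + a + b + e, by omega, ha.trans ?_, hb.trans ?_, he.trans ?_⟩ <;>
    exact_mod_cast (by omega)

/-- The mean square error of the server model after the burn-in `k₁`. -/
theorem StochasticModel.meanSq_xs_le
    (h : StochasticModel P f σ p ps M (stepSize p ps M μ L) x₀ J G)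
    (hn : 0 < n) (hM : 0 < M) (hμ : 0 < μ) (hμL : μ ≤ L) (hp : ∀ i, 0 < p i) (hps : 0 < ps)
    (hps1 : ps ≤ 1) (hs : ∀ i, IsSmooth L (f i)) (hc : ∀ i, IsStronglyConvex μ (f i))
    {x : EuclideanSpace ℝ (Fin d)} (hx : ∑ i, gradient (f i) x = 0) {ζ ρ : ℝ}
    (hζ : ∀ i, ‖gradient (f i) x‖ ≤ L * ζ) (hζ0 : 0 ≤ ζ) (hσ0 : 0 < σ)
    (hx₀ : ‖x₀ - x‖ ≤ ρ * max σ ζ) {c : ℝ} (hceq : c = pMin p ps * M * gam μ L / 48) {k₁ : ℕ}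
    (hk4 : 4 ≤ k₁) (hk8 : 8 / (c * stepBound M μ L) ≤ k₁) (hkL : L ^ 2 * 2 / (c * μ) ≤ k₁)
    (hkM : M * μ * 9 / (4 * c) ≤ k₁) {k : ℕ} (hk : k₁ ≤ k) :
    meanSq P (fun ω => (randomState M (stepSize p ps M μ L) x₀ J G k ω).xs) x
      ≤ ps * (3456 * σ ^ 2 / (pMin p ps ^ 2 * M * μ ^ 2) / (3 * k)
        + (20736 * qBar p * (L * ζ) ^ 2 / (pMin p ps ^ 2 * μ ^ 2)
          + 165888 * L ^ 2 * (L * ζ) ^ 2 * (1 - 1 / (M : ℝ)) ^ 2 / (pMin p ps ^ 3 * μ ^ 4))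
            / (2 * (k : ℝ) ^ 2)
        + initialEnergy p ps M L (stepBound M μ L) ρ k₁ * (k₁ : ℝ) ^ 3 * (σ ^ 2 + ζ ^ 2)
            / (k : ℝ) ^ 3) := by
  have hL : 0 < L := by linarith
  have hM1 : (1 : ℝ) ≤ M := by exact_mod_cast hM
  have hpm := pMin_pos hn hp hps
  have hg0 := gam_pos hμ hL
  have hg1 := le_gam hμ hμL
  have hg2 := gam_le hμ hL
  have hD := stepBound_pos hM hμ hL
  have hq := qBar_nonneg hp
  set pm := pMin p ps with hpmdef
  set D := stepBound M μ L with hDdef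
  set γ := gam μ L with hγ
  have hc0 : 0 < c := by
    rw [hceq]
    positivity
  set α := stepSize p ps M μ L with hα
  have hαeq : ∀ k, α k = 1 / (c * k + 1 / D) := fun k => by
    rw [hα, stepSize_eq, hceq]
  have hα0 : ∀ k, 0 < α k := fun k => by
    rw [hαeq]
    exact harmonicStep_pos hc0 hD k
  have hαD : ∀ k, α k ≤ D := fun k => by
    rw [hαeq]
    exact harmonicStep_le hc0 hD k
  have hαc : ∀ k, k₁ ≤ k → α k ≤ 1 / (c * k) := fun k hk => by
    rw [hαeq]
    exact harmonicStep_le_div hc0 hD (by omega)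
  have hkpos : ∀ k, k₁ ≤ k → (0 : ℝ) < k := fun k hk => by exact_mod_cast (by omega : 0 < k)
  have hkcast : ∀ k, k₁ ≤ k → (k₁ : ℝ) ≤ k := fun k hk => by exact_mod_cast hk
  have hαL : ∀ k, k₁ ≤ k → α k * L ^ 2 ≤ μ / 2 := fun k hk => by
    have h1 := hkpos k hk
    have h2 := hkL.trans (hkcast k hk)
    calc α k * L ^ 2 ≤ 1 / (c * k) * L ^ 2 := by
          have := hαc k hk
          gcongr
      _ ≤ μ / 2 := by
          rw [div_le_iff₀ (by positivity)] at h2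
          rw [one_div_mul_eq_div, div_le_iff₀ (by positivity)]
          linarith
  have hαM : ∀ k, k₁ ≤ k → M * (μ * α k) ≤ 4 / 9 := fun k hk => by
    have h1 := hkpos k hk
    have h2 := hkM.trans (hkcast k hk)
    calc M * (μ * α k) ≤ M * (μ * (1 / (c * k))) := by
          have := hαc k hk
          gcongr
      _ = M * μ / (c * k) := by ring
      _ ≤ 4 / 9 := by
          rw [div_le_iff₀ (by positivity)] at h2
          rw [div_le_iff₀ (by positivity)]
          linarith
  have hclow : pm * M * μ / 48 ≤ c := by
    rw [hceq]
    gcongr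
  have hcup : c ≤ pm * M * μ / 24 := by
    calc c = pm * M * γ / 48 := hceq
      _ ≤ pm * M * (2 * μ) / 48 := by gcongr
      _ = pm * M * μ / 24 := by ring
  set V : ℕ → ℝ := fun k =>
    energy P f p ps M x (randomState M α x₀ J G k) (M * (μ * α k) / 4) (α k) with hV
  have hV0 : ∀ k, k₁ ≤ k → 0 ≤ V k := fun k hk =>
    energy_nonneg hp hps (by linarith [hαM k hk]) x _ _
  have hdec : ∀ k, k₁ ≤ k → V (k + 1) ≤ (1 - 4 / ((k + 1 : ℕ) : ℝ)) * V k
      + 3456 * σ ^ 2 / (pm ^ 2 * M * μ ^ 2) / ((k + 1 : ℕ) : ℝ) ^ 2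
      + (20736 * qBar p * (L * ζ) ^ 2 / (pm ^ 2 * μ ^ 2)
        + 165888 * L ^ 2 * (L * ζ) ^ 2 * (1 - 1 / (M : ℝ)) ^ 2 / (pm ^ 3 * μ ^ 4))
          / ((k + 1 : ℕ) : ℝ) ^ 3 := by
    intro k hk
    have hk0 := hkpos k hk
    have hk' : k₁ ≤ k + 1 := by omega
    have hj0 := hkpos (k + 1) hk'
    have hmono : α (k + 1) ≤ α k := by
      rw [hαeq, hαeq]
      push_cast
      gcongr
      linarith
    have hk1 : (1 : ℝ) ≤ k := by exact_mod_cast (by omega : 1 ≤ k)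
    refine (h.energy_succ_le hn hM hμ hL hp hps hpm (pMin_le_server.trans hps1) pMin_le
      pMin_le_server hs hc hx hζ k (hα0 _) hmono (hαL _ hk') (hαM k hk)).trans
      (decrease_le_of_stepSize hM1 hpm hμ hq (mul_nonneg hL.le hζ0) hj0 (hV0 k hk)
        ?_ ?_ hmono ?_)
    · calc 64 / 3 / (pm * M * μ * (k + 1 : ℕ))
          = 8 / (9 * (pm * M * μ / 24 * (k + 1 : ℕ))) := by
            field_simp
            norm_num
        _ ≤ 8 / (9 * (c * (k + 1 : ℕ))) := by gcongr
        _ ≤ α (k + 1) := by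
            rw [hαeq]
            exact le_harmonicStep hc0 hD (hk8.trans (hkcast _ hk'))
    · calc α (k + 1) ≤ 1 / (c * (k + 1 : ℕ)) := hαc _ hk'
        _ ≤ 1 / (pm * M * μ / 48 * (k + 1 : ℕ)) := by gcongr
        _ = 48 / (pm * M * μ * (k + 1 : ℕ)) := by field_simp
    · calc α k - α (k + 1) ≤ 1 / (c * k * (k + 1 : ℕ)) := by
            rw [hαeq, hαeq]
            exact harmonicStep_sub_le hc0 hD (by omega)
        _ ≤ 1 / (pm * M * μ / 48 * (((k + 1 : ℕ) : ℝ) / 2) * (k + 1 : ℕ)) := by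
            gcongr
            push_cast
            linarith
        _ = 96 / (pm * M * μ * ((k + 1 : ℕ) : ℝ) ^ 2) := by
            field_simp
            norm_num
  set E := initialEnergy p ps M L D ρ k₁ with hE
  have hE0 : 0 ≤ E := initialEnergy_nonneg hp hps D ρ k₁
  have hmax : max σ ζ ^ 2 ≤ σ ^ 2 + ζ ^ 2 := by
    rcases max_cases σ ζ with ⟨e, _⟩ | ⟨e, _⟩ <;> rw [e] <;> nlinarith [sq_nonneg σ, sq_nonneg ζ]
  have hinit : V k₁ ≤ E * (σ ^ 2 + ζ ^ 2) := by
    refine (h.energy_le_initialEnergy (D := max σ ζ ^ 2) (ρ := ρ) hn hL.le hp hps hs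
      (fun k => (hα0 k).le) hαD hζ ?_ ?_ ?_ (by linarith [hαM k₁ le_rfl]) k₁).trans
      (mul_le_mul_of_nonneg_left hmax hE0)
    · gcongr
      exact le_max_right _ _
    · gcongr
      exact le_max_left _ _
    · rw [← mul_pow]
      gcongr
  have hfin := le_of_contraction (by positivity) (by positivity) (by positivity) hk4 hinit hdec k hk
  refine (server_le_energy hp hps (by linarith [hαM k hk]) x
    (randomState M α x₀ J G k) (α k)).trans (mul_le_mul_of_nonneg_left (hfin.trans_eq ?_) hps.le)
  ring

end Convergence

end AREA

theorem theorem1 :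
    -- an absolute constant
    ∃ C : ℝ, 0 < C ∧
      ∀ (n M : ℕ) (_ : 0 < n) (_ : 0 < M)
        (μ L : ℝ) (_ : 0 < μ) (_ : 0 < L)
        (p : Fin n → ℝ) (ps : ℝ) (_ : ∀ i, 0 < p i) (_ : 0 < ps) (_ : ps + ∑ i, p i = 1)
        (ρ : ℝ),
      -- a threshold that depends only on the quantities above
      ∃ K₀ : ℕ,
        ∀ (d : ℕ) (f : Fin n → EuclideanSpace ℝ (Fin d) → ℝ)
          (_ : ∀ i, AREA.IsSmooth L (f i)) (_ : ∀ i, AREA.IsStronglyConvex μ (f i))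
          (xstar : EuclideanSpace ℝ (Fin d)) (_ : IsMinOn (AREA.globalLoss f) Set.univ xstar)
          (u : Fin n → EuclideanSpace ℝ (Fin d)) (_ : ∀ i, IsMinOn (f i) Set.univ (u i))
          (σ : ℝ) (_ : 0 < σ)
          (x₀ : EuclideanSpace ℝ (Fin d))
          (_ : ‖x₀ - xstar‖ ≤ ρ * max σ (AREA.heterogeneity xstar u))
          (Ω : Type*) (_ : MeasurableSpace Ω) (P : Measure Ω) (_ : IsProbabilityMeasure P)
          (J : ℕ → Ω → Option (Fin n)) (G : ℕ → Fin n → ℕ → Ω → EuclideanSpace ℝ (Fin d))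
          (_ : AREA.StochasticModel P f σ p ps M (AREA.stepSize p ps M μ L) x₀ J G),
        let xs : ℕ → Ω → EuclideanSpace ℝ (Fin d) := fun k ω =>
          (AREA.iterate M (AREA.stepSize p ps M μ L) x₀
            (fun l => J l ω) (fun l i m => G l i m ω) k).xs
        (∀ K : ℕ, Integrable (fun ω => ‖xs K ω - xstar‖ ^ 2) P) ∧
        ∀ K : ℕ, K₀ ≤ K →
          ∫ ω, ‖xs K ω - xstar‖ ^ 2 ∂P
            ≤ C * max 1 (1 / μ ^ 4)
              * AREA.rate p ps M μ L σ (AREA.heterogeneity xstar u) K := by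
  refine ⟨100000, by norm_num, ?_⟩
  intro n M hn hM μ L hμ hL p ps hp hps hsum ρ
  have hps1 : ps ≤ 1 := by
    have : 0 ≤ ∑ i, p i := Finset.sum_nonneg fun i _ => (hp i).le
    linarith
  have hpm := AREA.pMin_pos hn hp hps
  have hpm1 : AREA.pMin p ps ≤ 1 := AREA.pMin_le_server.trans hps1
  obtain ⟨k₁, hk4, hk8, hkL, hkM⟩ := AREA.exists_burnIn M μ L
    (AREA.pMin p ps * M * AREA.gam μ L / 48) (AREA.stepBound M μ L)
  -- the transient constant, and the iterations from which on the transient is negligible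
  -- compared with the first and with the last term of the rate
  set T := AREA.initialEnergy p ps M L (AREA.stepBound M μ L) ρ k₁ * (k₁ : ℝ) ^ 3
  obtain ⟨k₂, hk₂⟩ := exists_nat_ge
    (ps * T / (ps / AREA.pMin p ps / (AREA.pMin p ps * M)))
  obtain ⟨k₃, hk₃⟩ := exists_nat_ge (ps * T / (ps / AREA.pMin p ps
    * (Real.sqrt (AREA.pMin p ps) * AREA.qBar p) * L ^ 4 / AREA.pMin p ps ^ 2))
  refine ⟨k₁ + k₂ + k₃, ?_⟩
  intro d f hs hc xstar hxs u hu σ hσ x₀ hx₀ Ω mΩ P hP J G h xs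
  refine ⟨fun K => AREA.integrable_norm_sub_sq (h.memLp_randomState hn hs K).1 xstar, ?_⟩
  intro K hK
  have hζ0 := AREA.heterogeneity_nonneg xstar u
  set ζ := AREA.heterogeneity xstar u
  have hlead := AREA.leading_le_rate hn hM hp hps hμ hL hσ.le hζ0 K
  have hM1 : (1 : ℝ) ≤ M := by exact_mod_cast hM
  have hδ : 0 ≤ 1 - 1 / (M : ℝ) := by
    rw [sub_nonneg, div_le_one (by linarith)]
    exact hM1
  have hq0 := AREA.qBar_nonneg hp
  rcases (hc ⟨0, hn⟩).subsingleton_or_le (hs ⟨0, hn⟩) with hsub | hμL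
  · -- in dimension zero the error vanishes; here `μ ≤ L` may fail
    have h0 : ∀ ω, ‖xs K ω - xstar‖ ^ 2 = 0 := fun ω => by
      rw [Subsingleton.elim (xs K ω) xstar]
      simp
    simp only [h0, integral_zero]
    have : 0 ≤ AREA.rate p ps M μ L σ ζ K := le_trans (by positivity) hlead
    positivity
  · have : Nonempty (Fin n) := ⟨⟨0, hn⟩⟩
    have hq : 0 < AREA.qBar p := mul_pos (by positivity)
      (Finset.sum_pos (fun i _ => one_div_pos.2 (hp i)) Finset.univ_nonempty)
    have hbound := h.meanSq_xs_le hn hM hμ hμL hp hps hps1 hs hc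
      (AREA.sum_gradient_eq_zero hn hs hxs)
      (AREA.norm_gradient_le_heterogeneity hL.le hs xstar hu) hζ0 hσ hx₀ rfl hk4 hk8 hkL hkM
      (by omega : k₁ ≤ K)
    have hK1 : (1 : ℝ) ≤ K := by exact_mod_cast (by omega : 1 ≤ K)
    refine hbound.trans ((AREA.bound_le_leading hpm hpm1 hps hM1 hμ hμL hq hδ
      (by linarith [one_div_nonneg.2 (zero_le_one.trans hM1)]) hK1 rfl rfl
      (hk₂.trans (by exact_mod_cast (by omega)))
      (hk₃.trans (by exact_mod_cast (by omega)))).trans ?_)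
    exact mul_le_mul_of_nonneg_left hlead (by positivity)
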